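/- Corollary 2.4 (Eisenstein series decomposition). Let $\Gamma=\mathrm{Sp}_4(\mathbb{Z})$, with elements written in $2\times 2$ blocks $\gamma=\begin{pmatrix}A_\gamma&B_\gamma\\C_\gamma&D_\gamma\end{pmatrix}$, let $\Gamma_\infty=\{\gamma\in\Gamma: C_\gamma=0\}$, $\Gamma_0(N)=\{\gamma\in\Gamma: C_\gamma\equiv 0 \bmod N\}$, and let $\mathbb{H}_2$ be the set of symmetric complex $2\times2$ matrices with positive definite imaginary part. Let $k\ge 4$ be an even integer. For positive integers $N_0,N_1,N_2$ with $N_0N_1N_2$ squarefree, choose a symmetric matrix $M\in\mathbb{Z}^{2\times2}$ with $$M\equiv\begin{pmatrix}0&0\\0&0\end{pmatrix}\bmod N_0,\qquad M\equiv\begin{pmatrix}1&0\\0&0\end{pmatrix}\bmod N_1,\qquad M\equiv\begin{pmatrix}1&0\\0&1\end{pmatrix}\bmod N_2,$$ put $\gamma_0=\begin{pmatrix}I&0\\M&I\end{pmatrix}$, and define the Siegel--Eisenstein series of degree $2$, weight $k$, level $N_0N_1N_2$ and trivial character by $$\mathbb{E}_{(N_0,N_1,N_2)}(Z)=\sum_{\gamma}\det(C_\gamma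 Z+D_\gamma)^{-k}\qquad(Z\in\mathbb{H}_2),$$ where $\gamma$ runs over representatives of the cosets in $\Gamma_\infty\backslash\bigl(\Gamma_\infty\,\gamma_0\,\Gamma_0(N_0N_1N_2)\bigr)$. Let $N$ be a squarefree positive integer, let $N_0,N_1,N_2$ be positive integers with $N_0N_1N_2=N$, and let $p$ be a prime not dividing $N$. Then, for any choices of the matrices $M$, the four series below converge absolutely at every $Z\in\mathbb{H}_2$, and $$\mathbb{E}_{(N_0,N_1,N_2)}=\mathbb{E}_{(pN_0,N_1,N_2)}+\mathbb{E}_{(N_0,pN_1,N_2)}+\mathbb{E}_{(N_0,N_1,pN_2)}$$ as functions on $\mathbb{H}_2$. -/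

import Mathlib

namespace SiegelEis

open scoped Matrix

/-- The Siegel upper half space of degree `2`: symmetric complex `2 × 2` matrices with positive
definite imaginary part. -/
def UpperHalf : Type :=
  {Z : Matrix (Fin 2) (Fin 2) ℂ // Z.IsSymm ∧ (Z.map Complex.im).PosDef}

/-- `Γ = Sp₄(ℤ)`, as block matrices `(A, B; C, D)` with `2 × 2` blocks. -/
abbrev Sp4Z : Type := Matrix.symplecticGroup (Fin 2) ℤ

/-- The block `C` of `(A, B; C, D)`. -/
def blockC (γ : Sp4Z) : Matrix (Fin 2) (Fin 2) ℤ := γ.1.toBlocks₂₁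

/-- The block `D` of `(A, B; C, D)`. -/
def blockD (γ : Sp4Z) : Matrix (Fin 2) (Fin 2) ℤ := γ.1.toBlocks₂₂

theorem blockC_one : blockC 1 = 0 := by
  ext i j
  simp [blockC, Matrix.toBlocks₂₁]

theorem blockC_mul (γ δ : Sp4Z) :
    blockC (γ * δ) = blockC γ * δ.1.toBlocks₁₁ + blockD γ * blockC δ := by
  ext i j
  simp [blockC, blockD, Matrix.toBlocks₂₁, Matrix.toBlocks₁₁, Matrix.toBlocks₂₂,
    Matrix.mul_apply]

theorem blockD_mul (γ δ : Sp4Z) :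
    blockD (γ * δ) = blockC γ * δ.1.toBlocks₁₂ + blockD γ * blockD δ := by
  ext i j
  simp [blockC, blockD, Matrix.toBlocks₂₁, Matrix.toBlocks₁₂, Matrix.toBlocks₂₂,
    Matrix.mul_apply]

theorem blockC_inv (γ : Sp4Z) : blockC γ⁻¹ = -(blockC γ)ᵀ := by
  ext i j
  simp [blockC, Matrix.toBlocks₂₁, SymplecticGroup.coe_inv, Matrix.J, Matrix.mul_apply,
    Matrix.fromBlocks, Matrix.one_apply]

/-- `Γ_∞`: the elements of `Sp₄(ℤ)` with `C = 0`. -/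
def GammaInf : Subgroup Sp4Z where
  carrier := {γ | blockC γ = 0}
  one_mem' := blockC_one
  mul_mem' {γ δ} hγ hδ := by
    simp only [Set.mem_ofPred_eq] at hγ hδ ⊢
    rw [blockC_mul, hγ, hδ]
    simp
  inv_mem' {γ} hγ := by
    simp only [Set.mem_ofPred_eq] at hγ ⊢
    rw [blockC_inv, hγ]
    simp

/-- `Γ₀(N)`: the elements of `Sp₄(ℤ)` with `C ≡ 0 mod N`. -/
def Gamma0 (N : ℕ) : Subgroup Sp4Z where
  carrier := {γ | ∀ i j, (N : ℤ) ∣ blockC γ i j}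
  one_mem' := by simp [blockC_one]
  mul_mem' {γ δ} hγ hδ := by
    intro i j
    rw [blockC_mul, Matrix.add_apply, Matrix.mul_apply, Matrix.mul_apply]
    exact dvd_add (Finset.dvd_sum fun l _ => (hγ i l).mul_right _)
      (Finset.dvd_sum fun l _ => (hδ l j).mul_left _)
  inv_mem' {γ} hγ := by
    intro i j
    rw [blockC_inv, Matrix.neg_apply, Matrix.transpose_apply]
    exact (dvd_neg).2 (hγ j i)

/-- The set `Γ_∞ \ Γ` of right cosets `Γ_∞ γ`. -/
abbrev Cosets : Type := Quotient (QuotientGroup.rightRel GammaInf)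

/-- `det (C Z + D)` for `γ = (A, B; C, D)`. -/
noncomputable def autFactor (γ : Sp4Z) (Z : UpperHalf) : ℂ :=
  ((blockC γ).map (Int.cast : ℤ → ℂ) * Z.1 + (blockD γ).map (Int.cast : ℤ → ℂ)).det

/-- The summand `det (C_γ Z + D_γ)^(-k)` attached to a coset `Γ_∞ γ`, formed with a chosen
representative `γ`; for even `k` the choice does not matter, see `eisTerm_mk`. -/
noncomputable def eisTerm (k : ℕ) (Z : UpperHalf) (c : Cosets) : ℂ :=
  autFactor c.out Z ^ (-(k : ℤ))

theorem autFactor_mul (g γ : Sp4Z) (hg : g ∈ GammaInf) (Z : UpperHalf) :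
    autFactor (g * γ) Z = ((blockD g).det : ℂ) * autFactor γ Z := by
  have hC : blockC g = 0 := hg
  have hdet : ((blockD g).det : ℂ) = ((blockD g).map (Int.cast : ℤ → ℂ)).det :=
    Int.cast_det (blockD g)
  have hm : ∀ X Y : Matrix (Fin 2) (Fin 2) ℤ, (X * Y).map (Int.cast : ℤ → ℂ) =
      X.map (Int.cast : ℤ → ℂ) * Y.map (Int.cast : ℤ → ℂ) := fun X Y =>
    Matrix.map_mul (f := Int.castRingHom ℂ)
  rw [autFactor, autFactor, blockC_mul, blockD_mul, hC, hdet, ← Matrix.det_mul]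
  simp [hm, Matrix.mul_add, Matrix.mul_assoc]

theorem det_blockD_sq (g : Sp4Z) (hg : g ∈ GammaInf) : (blockD g).det ^ 2 = 1 := by
  have h : blockD (g * g⁻¹) = blockD g * blockD g⁻¹ := by
    have hC : blockC g = 0 := hg
    rw [blockD_mul, hC]
    simp
  have h1 : blockD (g * g⁻¹) = 1 := by
    rw [mul_inv_cancel]
    ext i j
    simp [blockD, Matrix.toBlocks₂₂, Matrix.one_apply]
  rw [h1] at h
  have hu : IsUnit (blockD g).det :=
    IsUnit.of_mul_eq_one (blockD g⁻¹).det (by rw [← Matrix.det_mul, ← h, Matrix.det_one])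
  rcases Int.isUnit_iff.1 hu with h2 | h2 <;> simp [h2]

/-- For even `k` the summand depends only on the coset `Γ_∞ γ`. -/
theorem eisTerm_mk {k : ℕ} (hk : Even k) (Z : UpperHalf) (γ : Sp4Z) :
    eisTerm k Z (Quotient.mk _ γ) = autFactor γ Z ^ (-(k : ℤ)) := by
  have hrel : QuotientGroup.rightRel GammaInf (Quotient.mk _ γ : Cosets).out γ :=
    Quotient.mk_out γ
  rw [QuotientGroup.rightRel_apply] at hrel
  set δ := (Quotient.mk _ γ : Cosets).out with hδ
  have hγ : γ = (γ * δ⁻¹) * δ := by simp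
  obtain ⟨m, rfl⟩ := hk
  have hsq : (((blockD (γ * δ⁻¹)).det : ℤ) : ℂ) ^ (m + m) = 1 := by
    rw [← two_mul, pow_mul]
    have := det_blockD_sq _ hrel
    have h2 : (((blockD (γ * δ⁻¹)).det : ℤ) : ℂ) ^ 2 = 1 := by exact_mod_cast this
    rw [h2, one_pow]
  conv_rhs => rw [hγ, autFactor_mul _ _ hrel]
  rw [eisTerm, ← hδ, _root_.zpow_neg, _root_.zpow_neg, zpow_natCast, zpow_natCast, mul_pow, hsq, one_mul]

/-- An integral symmetric matrix `M` that is `0` mod `N₀`, `diag(1, 0)` mod `N₁` and the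
identity mod `N₂`. -/
structure CuspMatrix (N₀ N₁ N₂ : ℕ) where
  mat : Matrix (Fin 2) (Fin 2) ℤ
  symm : mat.IsSymm
  mod₀ : mat.map (Int.cast : ℤ → ZMod N₀) = !![0, 0; 0, 0]
  mod₁ : mat.map (Int.cast : ℤ → ZMod N₁) = !![1, 0; 0, 0]
  mod₂ : mat.map (Int.cast : ℤ → ZMod N₂) = !![1, 0; 0, 1]

/-- Such matrices exist whenever `N₀ N₁ N₂` is squarefree. -/
theorem CuspMatrix.nonempty {N₀ N₁ N₂ : ℕ} (h : Squarefree (N₀ * N₁ * N₂)) :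
    Nonempty (CuspMatrix N₀ N₁ N₂) := by
  have h01_2 : (N₀ * N₁).Coprime N₂ := Nat.coprime_of_squarefree_mul h
  have h0_12 : N₀.Coprime (N₁ * N₂) := by
    rw [mul_assoc] at h
    exact Nat.coprime_of_squarefree_mul h
  obtain ⟨a, ha0, ha12⟩ := Nat.chineseRemainder h0_12 0 1
  obtain ⟨d, hd01, hd2⟩ := Nat.chineseRemainder h01_2 0 1
  have ha1 := ha12.of_mul_right N₂
  have ha2 := ha12.of_mul_left N₁
  have hd0 := hd01.of_mul_right N₁
  have hd1 := hd01.of_mul_left N₀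
  rw [← ZMod.natCast_eq_natCast_iff] at ha0 ha1 ha2 hd0 hd1 hd2
  refine ⟨⟨!![(a : ℤ), 0; 0, (d : ℤ)], ?_, ?_, ?_, ?_⟩⟩
  · ext i j
    fin_cases i <;> fin_cases j <;> simp
  all_goals
    ext i j
    fin_cases i <;> fin_cases j <;> simp_all

/-- The element `γ₀ = (I, 0; M, I)` of `Sp₄(ℤ)`. -/
def CuspMatrix.gamma {N₀ N₁ N₂ : ℕ} (M : CuspMatrix N₀ N₁ N₂) : Sp4Z :=
  ⟨Matrix.fromBlocks 1 0 M.mat 1, by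
    rw [SymplecticGroup.fromBlocks_mem_iff]
    refine ⟨?_, ?_, ?_⟩
    · simpa using M.symm.symm
    · simp
    · simp⟩

/-- The set of cosets `Γ_∞ γ` contained in the double coset `Γ_∞ γ₀ Γ₀(N)`, where
`N = N₀ N₁ N₂` and `γ₀ = (I, 0; M, I)`. -/
def cuspCosets {N₀ N₁ N₂ : ℕ} (M : CuspMatrix N₀ N₁ N₂) : Set Cosets :=
  (Quotient.mk _) '' DoubleCoset.doubleCoset M.gamma (GammaInf : Set Sp4Z)
    (Gamma0 (N₀ * N₁ * N₂) : Set Sp4Z)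

/-- The series defining the Eisenstein series converges (absolutely) at every point. -/
def EisConverges (k : ℕ) {N₀ N₁ N₂ : ℕ} (M : CuspMatrix N₀ N₁ N₂) : Prop :=
  ∀ Z : UpperHalf, Summable fun c : cuspCosets M => eisTerm k Z c

/-- The Eisenstein series `𝔼_(N₀, N₁, N₂)` of weight `k` and level `N = N₀ N₁ N₂`, formed with
the matrix `M = M_(N₀, N₁, N₂)`: the sum of `det (C_γ Z + D_γ)^(-k)` over the cosets `Γ_∞ γ` in
`Γ_∞ γ₀ Γ₀(N)`. -/
noncomputable def eisenstein (k : ℕ) {N₀ N₁ N₂ : ℕ} (M : CuspMatrix N₀ N₁ N₂) : UpperHalf → ℂ :=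
  fun Z => ∑' c : cuspCosets M, eisTerm k Z c

end SiegelEis

/-! ### Summability of `height ^ (-4)` over the integral points of the quadric. -/

namespace SiegelEis

open scoped Matrix
open Finset

/-! A coset `Γ_∞ γ` lies in `Γ_∞ γ₀ Γ₀(N)` exactly when, for each prime dividing `N₀`, `N₁`, `N₂`,
the block `C_γ` has rank 0, 1, 2 modulo that prime (`mk_mem_cuspCosets_iff`). Passing from level `N`
to `pN` prescribes the rank modulo `p` as well. This rank takes exactly one of the values 0, 1, 2,
so the cosets for `N` are the disjoint union of the three families at level `pN`, and the series
splits once it converges absolutely.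

In the rank criterion, necessity holds because `C ≡ D_g M A_h` modulo primes dividing `N`, with
invertible outer factors. For sufficiency, one solves at each prime for an element of the Siegel
parabolic that carries `γ` into `γ₀ Γ₀(q)`; the Chinese remainder theorem and strong approximation
for `SL₂(ℤ)` glue the solutions.

For convergence, the minors of `(C, D)` embed the cosets into the integral points of the quadric `ab
+ cd + e² = 0`. At fixed `Z` the height of such a point is bounded by a constant times `‖det (C Z +
D)‖` (`exists_height_le`), and the divisor bound makes `height ^ (-4)` summable over the quadric
(`summable_height`). -/

theorem succ_pow_four_le (e : ℕ) : (e + 1) ^ 4 ≤ 4096 * 2 ^ e := by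
  induction e with
  | zero => norm_num
  | succ n ih =>
    rcases Nat.lt_or_ge n 6 with h | h
    · interval_cases n <;> norm_num
    -- For `n ≥ 6` the ratio of consecutive fourth powers is at most `(8/7)^4 < 2`.
    · have : (n + 1 + 1) ^ 4 ≤ 2 * (n + 1) ^ 4 := by
        obtain ⟨m, rfl⟩ := Nat.exists_eq_add_of_le h
        ring_nf
        nlinarith [Nat.zero_le m, Nat.zero_le (m ^ 2), Nat.zero_le (m ^ 3), Nat.zero_le (m ^ 4)]
      rw [pow_succ 2 n]
      omega

theorem succ_pow_four_le_pow {p : ℕ} (hp : 16 ≤ p) (e : ℕ) : (e + 1) ^ 4 ≤ p ^ e :=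
  calc (e + 1) ^ 4 ≤ (2 ^ e) ^ 4 := by
        gcongr
        exact Nat.lt_two_pow_self
    _ = 16 ^ e := by rw [← pow_mul, mul_comm, pow_mul]; norm_num
    _ ≤ p ^ e := by gcongr

/-- The divisor bound `d(n) ≪ n ^ (1/4)`. -/
theorem card_divisors_pow_four_le (n : ℕ) : #n.divisors ^ 4 ≤ 4096 ^ 16 * n := by
  rcases eq_or_ne n 0 with rfl | hn
  · simp
  rw [Nat.card_divisors hn, ← prod_pow]
  conv_rhs => rw [← Nat.prod_factorization_pow_eq_self hn, Finsupp.prod,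
    Nat.support_factorization]
  -- Only primes below `16 = 2^4` cost a constant, and there are at most 16 of them; this gives the
  -- factor `4096 ^ 16`.
  have key : ∀ p ∈ n.primeFactors, (n.factorization p + 1) ^ 4 ≤
      (if p < 16 then 4096 else 1) * p ^ n.factorization p := by
    intro p hp
    split_ifs with h
    · refine (succ_pow_four_le _).trans ?_
      gcongr
      exact (Nat.prime_of_mem_primeFactors hp).two_le
    · rw [one_mul]
      exact succ_pow_four_le_pow (by omega) _
  refine (prod_le_prod' key).trans ?_
  rw [prod_mul_distrib]
  gcongr
  rw [prod_ite, prod_const, prod_const_one, mul_one]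
  refine Nat.pow_le_pow_right (by norm_num) ?_
  calc #{x ∈ n.primeFactors | x < 16} ≤ #(range 16) := by
        apply card_le_card
        intro x
        simp
    _ = 16 := card_range _

/-- The finite set of integers dividing the nonzero integer `n`. -/
def intDivisors (n : ℤ) : Finset ℤ :=
  n.natAbs.divisors.image (fun d : ℕ => (d : ℤ)) ∪ n.natAbs.divisors.image (fun d : ℕ => -(d : ℤ))

theorem mem_intDivisors {n a : ℤ} (hn : n ≠ 0) (h : a ∣ n) : a ∈ intDivisors n := by
  simp only [intDivisors, mem_union, mem_image, Nat.mem_divisors]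
  have h1 : a.natAbs ∣ n.natAbs := Int.natAbs_dvd_natAbs.2 h
  rcases Int.natAbs_eq a with h2 | h2
  · exact Or.inl ⟨_, ⟨h1, by simpa using hn⟩, h2.symm⟩
  · exact Or.inr ⟨_, ⟨h1, by simpa using hn⟩, h2.symm⟩

theorem card_intDivisors_le (n : ℤ) : #(intDivisors n) ≤ 2 * #n.natAbs.divisors := by
  refine (card_union_le _ _).trans ?_
  rw [two_mul]
  exact add_le_add card_image_le card_image_le

theorem card_intDivisors_pow_four_le (n : ℤ) :
    (#(intDivisors n) : ℝ) ^ 4 ≤ 16 * 4096 ^ 16 * |(n : ℝ)| := by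
  have h1 : #(intDivisors n) ^ 4 ≤ 16 * (4096 ^ 16 * n.natAbs) :=
    calc #(intDivisors n) ^ 4 ≤ (2 * #n.natAbs.divisors) ^ 4 := by
          gcongr
          exact card_intDivisors_le n
      _ = 16 * #n.natAbs.divisors ^ 4 := by rw [mul_pow]; norm_num
      _ ≤ _ := by gcongr; exact card_divisors_pow_four_le _
  have h2 : ((#(intDivisors n) ^ 4 : ℕ) : ℝ) ≤ ((16 * (4096 ^ 16 * n.natAbs) : ℕ) : ℝ) :=
    Nat.cast_le.2 h1
  have h3 : (n.natAbs : ℝ) = |(n : ℝ)| := by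
    rw [Nat.cast_natAbs, Int.cast_abs]
  rw [Nat.cast_pow, Nat.cast_mul, Nat.cast_mul, h3] at h2
  rw [mul_assoc]
  exact_mod_cast h2

/-- The truncated absolute value `max 1 |x|` of an integer. -/
noncomputable def weight (x : ℤ) : ℝ := max 1 |(x : ℝ)|

theorem one_le_weight (x : ℤ) : 1 ≤ weight x := le_max_left _ _

theorem weight_pos (x : ℤ) : 0 < weight x := one_pos.trans_le (one_le_weight x)

theorem abs_le_weight (x : ℤ) : |(x : ℝ)| ≤ weight x := le_max_right _ _

theorem summable_weight_rpow {r : ℝ} (hr : 1 < r) : Summable fun x : ℤ => weight x ^ (-r) := by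
  refine (summable_congr_cofinite ?_).1 (Real.summable_abs_int_rpow hr)
  filter_upwards [(Set.finite_singleton (0 : ℤ)).compl_mem_cofinite] with x hx
  have h1 : (1 : ℝ) ≤ |(x : ℝ)| := by exact_mod_cast Int.one_le_abs hx
  rw [weight, max_eq_right h1]

/-- Integral points of affine five-space. -/
abbrev Point : Type := ℤ × ℤ × ℤ × ℤ × ℤ

/-- The height `max 1 ‖x‖` of an integral point. -/
noncomputable def height (x : Point) : ℝ :=
  max (weight x.1) (max (weight x.2.1) (max (weight x.2.2.1) (max (weight x.2.2.2.1)
    (weight x.2.2.2.2))))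

theorem one_le_height (x : Point) : 1 ≤ height x := (one_le_weight x.1).trans (le_max_left _ _)

theorem height_pos (x : Point) : 0 < height x := one_pos.trans_le (one_le_height x)

/-- The quadric `ab + cd + e² = 0`, the Lagrangian Grassmannian of a four-dimensional
symplectic space. -/
def quadric : Set Point :=
  {x | x.1 * x.2.1 + x.2.2.1 * x.2.2.2.1 + x.2.2.2.2 ^ 2 = 0}

/-- With `m` the largest weight of `c, d, e`, we have `|cd + e²| ≤ 2m²`, so there are `O(m^(1/2))`
divisors `a`. The inner sum is therefore `O(m^(-7/2))`, and `m^(-7/2) = (m^(-7/6))^3` is at most the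
product of the three weights to the power `-7/6`, summable since `7/6 > 1`. -/
theorem summable_divisor_sum : Summable fun y : (ℤ × ℤ × ℤ) × ℤ =>
    if y.2 ∣ y.1.1 * y.1.2.1 + y.1.2.2 ^ 2 ∧ y.1.1 * y.1.2.1 + y.1.2.2 ^ 2 ≠ 0 then
      ((max (weight y.1.1) (max (weight y.1.2.1) (weight y.1.2.2))) ^ 4)⁻¹ else 0 := by
  have hfin : ∀ (t : ℤ × ℤ × ℤ) (v : ℝ), ∀ a ∉ intDivisors (t.1 * t.2.1 + t.2.2 ^ 2),
      (if a ∣ t.1 * t.2.1 + t.2.2 ^ 2 ∧ t.1 * t.2.1 + t.2.2 ^ 2 ≠ 0 then v else 0) = 0 := by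
    intro t v a ha
    rw [if_neg]
    rintro ⟨h1, h2⟩
    exact ha (mem_intDivisors h2 h1)
  rw [summable_prod_of_nonneg]
  · refine ⟨fun t => by
      dsimp only
      exact summable_of_ne_finset_zero (hfin t _), ?_⟩
    set K : ℝ := Real.sqrt (Real.sqrt (2 * (16 * 4096 ^ 16))) with hK
    have hsum : Summable fun t : ℤ × ℤ × ℤ =>
        K * (weight t.1 ^ (-(7 / 6) : ℝ) * (weight t.2.1 ^ (-(7 / 6) : ℝ) *
          weight t.2.2 ^ (-(7 / 6) : ℝ))) := by
      have h0 : Summable fun x : ℤ => weight x ^ (-(7 / 6) : ℝ) :=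
        summable_weight_rpow (by norm_num)
      have hnn : ∀ x : ℤ, 0 ≤ weight x ^ (-(7 / 6) : ℝ) := fun x =>
        Real.rpow_nonneg (weight_pos x).le _
      exact (h0.mul_of_nonneg (h0.mul_of_nonneg h0 hnn hnn) hnn
        (fun x => mul_nonneg (hnn _) (hnn _))).mul_left K
    refine Summable.of_nonneg_of_le (fun t => tsum_nonneg fun a => by
      dsimp only
      split_ifs <;> positivity) (fun t => ?_) hsum
    obtain ⟨c, d, e⟩ := t
    have hfin' := hfin (c, d, e) ((max (weight c) (max (weight d) (weight e))) ^ 4)⁻¹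
    dsimp only at hfin' ⊢
    rw [tsum_eq_sum hfin']
    set m : ℝ := max (weight c) (max (weight d) (weight e)) with hm
    have hc : weight c ≤ m := le_max_left _ _
    have hd : weight d ≤ m := (le_max_left _ _).trans (le_max_right _ _)
    have he : weight e ≤ m := (le_max_right _ _).trans (le_max_right _ _)
    have hm1 : 1 ≤ m := (one_le_weight c).trans hc
    have hm0 : 0 < m := one_pos.trans_le hm1
    have hcard : (#(intDivisors (c * d + e ^ 2)) : ℝ) ≤ K * m ^ (1 / 2 : ℝ) := by
      have h1 : |((c * d + e ^ 2 : ℤ) : ℝ)| ≤ 2 * m ^ 2 := by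
        push_cast
        refine (abs_add_le _ _).trans ?_
        rw [abs_mul, abs_pow, two_mul]
        have h2 : |(c : ℝ)| * |(d : ℝ)| ≤ m * m :=
          mul_le_mul ((abs_le_weight c).trans hc) ((abs_le_weight d).trans hd)
            (abs_nonneg _) hm0.le
        have h3 : |(e : ℝ)| ^ 2 ≤ m ^ 2 :=
          pow_le_pow_left₀ (abs_nonneg _) ((abs_le_weight e).trans he) 2
        nlinarith
      have h2 := card_intDivisors_pow_four_le (c * d + e ^ 2)
      have h3 : (K * m ^ (1 / 2 : ℝ)) ^ 4 = 2 * (16 * 4096 ^ 16) * m ^ 2 := by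
        rw [mul_pow, ← Real.sqrt_eq_rpow, hK]
        have h4 : ∀ x : ℝ, 0 ≤ x → Real.sqrt x ^ 4 = x ^ 2 := fun x hx => by
          rw [show (4 : ℕ) = 2 * 2 from rfl, pow_mul, Real.sq_sqrt hx]
        rw [h4 _ (Real.sqrt_nonneg _), h4 _ hm0.le, Real.sq_sqrt (by positivity)]
      refine le_of_pow_le_pow_left₀ (n := 4) (by norm_num) (by positivity) ?_
      rw [h3]
      refine h2.trans ?_
      rw [mul_comm 2 (16 * 4096 ^ 16 : ℝ), mul_assoc _ (2 : ℝ)]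
      exact mul_le_mul_of_nonneg_left h1 (by norm_num)
    have hpow : m ^ (1 / 2 : ℝ) * (m ^ 4)⁻¹ = m ^ (-(7 / 6) : ℝ) *
        (m ^ (-(7 / 6) : ℝ) * m ^ (-(7 / 6) : ℝ)) := by
      rw [← Real.rpow_natCast, ← Real.rpow_neg hm0.le, ← Real.rpow_add hm0,
        ← Real.rpow_add hm0, ← Real.rpow_add hm0]
      norm_num
    have hle : ∀ x : ℤ, weight x ≤ m → m ^ (-(7 / 6) : ℝ) ≤ weight x ^ (-(7 / 6) : ℝ) :=
      fun x hx => Real.rpow_le_rpow_of_nonpos (weight_pos x) hx (by norm_num)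
    have hwnn : ∀ x : ℤ, 0 ≤ weight x ^ (-(7 / 6) : ℝ) := fun x =>
        Real.rpow_nonneg (weight_pos x).le _
    calc ∑ a ∈ intDivisors (c * d + e ^ 2), (if a ∣ c * d + e ^ 2 ∧ c * d + e ^ 2 ≠ 0 then
            (m ^ 4)⁻¹ else 0) ≤ ∑ a ∈ intDivisors (c * d + e ^ 2), (m ^ 4)⁻¹ := by
          refine sum_le_sum fun a _ => ?_
          split_ifs
          · exact le_rfl
          · positivity
      _ = #(intDivisors (c * d + e ^ 2)) * (m ^ 4)⁻¹ := by rw [sum_const, nsmul_eq_mul]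
      _ ≤ K * m ^ (1 / 2 : ℝ) * (m ^ 4)⁻¹ := by gcongr
      _ = K * (m ^ (-(7 / 6) : ℝ) * (m ^ (-(7 / 6) : ℝ) * m ^ (-(7 / 6) : ℝ))) := by
          rw [mul_assoc, hpow]
      _ ≤ _ := by
          have hK0 : 0 ≤ K := Real.sqrt_nonneg _
          have h0 : 0 ≤ m ^ (-(7 / 6) : ℝ) := Real.rpow_nonneg hm0.le _
          refine mul_le_mul_of_nonneg_left ?_ hK0
          exact mul_le_mul (hle c hc) (mul_le_mul (hle d hd) (hle e he) h0 (hwnn _))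
            (mul_nonneg h0 h0) (hwnn _)
  · intro y
    dsimp only
    split_ifs <;> positivity

/-- When `ab ≠ 0`, the coordinate `a` divides the nonzero integer `cd + e² = -ab`, and `b` is
recovered from the other four coordinates. -/
theorem summable_height_of_ne_zero :
    Summable (({x | x.1 ≠ 0 ∧ x.2.1 ≠ 0} ∩ quadric).indicator
      fun x : Point => (height x ^ 4)⁻¹) := by
  rw [← summable_subtype_iff_indicator]
  set S : Set Point := {x | x.1 ≠ 0 ∧ x.2.1 ≠ 0} ∩ quadric
  let φ : S → (ℤ × ℤ × ℤ) × ℤ := fun x => (x.1.2.2, x.1.1)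
  have hφ : Function.Injective φ := by
    rintro ⟨⟨a, b, c, d, e⟩, ⟨ha, hb⟩, hx⟩ ⟨⟨a', b', c', d', e'⟩, ⟨ha', hb'⟩, hx'⟩ h
    simp only [φ, Prod.mk.injEq] at h
    obtain ⟨⟨rfl, rfl, rfl⟩, rfl⟩ := h
    simp only [quadric, Set.mem_ofPred_eq] at hx hx' ha
    have : a * b = a * b' := by linear_combination hx - hx'
    simp [mul_left_cancel₀ ha this]
  refine Summable.of_nonneg_of_le (fun x => inv_nonneg.2 (pow_nonneg (height_pos _).le 4))
    (fun x => ?_) (summable_divisor_sum.comp_injective hφ)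
  obtain ⟨⟨a, b, c, d, e⟩, ⟨ha, hb⟩, hx⟩ := x
  simp only [quadric, Set.mem_ofPred_eq] at hx ha hb
  have h1 : a ∣ c * d + e ^ 2 := ⟨-b, by linear_combination hx⟩
  have h2 : c * d + e ^ 2 ≠ 0 := by
    intro h
    have : a * b = 0 := by linear_combination hx - h
    simp_all
  simp only [φ, Function.comp_apply]
  rw [if_pos ⟨h1, h2⟩]
  have hw := weight_pos c
  refine inv_anti₀ (by positivity) (pow_le_pow_left₀ (by positivity) ?_ 4)
  simp [height]

/-- Splitting `height ^ (-4)` as `height ^ (-2) * height ^ (-2)` compares the sum with a convergent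
double sum. This handles the degenerate planes in the quadric. -/
theorem summable_height_of_injOn (S : Set Point) (φ : Point → ℤ × ℤ) (hφ : Set.InjOn φ S)
    (h1 : ∀ x, weight (φ x).1 ≤ height x) (h2 : ∀ x, weight (φ x).2 ≤ height x) :
    Summable (S.indicator fun x : Point => (height x ^ 4)⁻¹) := by
  rw [← summable_subtype_iff_indicator]
  have h0 : Summable fun x : ℤ => weight x ^ (-2 : ℝ) := summable_weight_rpow (by norm_num)
  have hnn : ∀ x : ℤ, 0 ≤ weight x ^ (-2 : ℝ) := fun x => Real.rpow_nonneg (weight_pos x).le _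
  refine Summable.of_nonneg_of_le (fun x => inv_nonneg.2 (pow_nonneg (height_pos _).le 4))
    (fun x => ?_) ((h0.mul_of_nonneg h0 hnn hnn).comp_injective hφ.injective)
  have hx := height_pos x.1
  have e : (height x.1 ^ 4)⁻¹ = height x.1 ^ (-2 : ℝ) * height x.1 ^ (-2 : ℝ) := by
    rw [← Real.rpow_natCast, ← Real.rpow_neg hx.le, ← Real.rpow_add hx]
    norm_num
  simp only [Function.comp_apply, Set.domRestrict_apply]
  rw [e]
  exact mul_le_mul (Real.rpow_le_rpow_of_nonpos (weight_pos _) (h1 _) (by norm_num))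
    (Real.rpow_le_rpow_of_nonpos (weight_pos _) (h2 _) (by norm_num))
    (Real.rpow_nonneg hx.le _) (hnn _)

theorem weight_le_height (x : Point) : weight x.1 ≤ height x ∧ weight x.2.1 ≤ height x ∧
    weight x.2.2.1 ≤ height x ∧ weight x.2.2.2.1 ≤ height x ∧ weight x.2.2.2.2 ≤ height x := by
  simp [height]

/-- The quadric is covered by the loci `ab ≠ 0` and `cd ≠ 0` and four coordinate planes: if `ab = cd
= 0`, then `e = 0`, and one factor of each product vanishes. -/
theorem summable_height : Summable (quadric.indicator fun x : Point => (height x ^ 4)⁻¹) := by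
  set f : Point → ℝ := fun x => (height x ^ 4)⁻¹ with hf
  have hf0 : ∀ x, 0 ≤ f x := fun x => inv_nonneg.2 (pow_nonneg (height_pos _).le 4)
  -- Exchanging `(a, b)` with `(c, d)` preserves both the quadric and the height.
  let σ : Point ≃ Point :=
    { toFun := fun x => (x.2.2.1, x.2.2.2.1, x.1, x.2.1, x.2.2.2.2)
      invFun := fun x => (x.2.2.1, x.2.2.2.1, x.1, x.2.1, x.2.2.2.2)
      left_inv := fun x => rfl
      right_inv := fun x => rfl }
  have s1 := summable_height_of_ne_zero
  have s2 := (Equiv.summable_iff σ).2 s1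
  let P₁ : Set Point := {x | x.2.1 = 0 ∧ x.2.2.2.1 = 0 ∧ x.2.2.2.2 = 0}
  let P₂ : Set Point := {x | x.2.1 = 0 ∧ x.2.2.1 = 0 ∧ x.2.2.2.2 = 0}
  let P₃ : Set Point := {x | x.1 = 0 ∧ x.2.2.2.1 = 0 ∧ x.2.2.2.2 = 0}
  let P₄ : Set Point := {x | x.1 = 0 ∧ x.2.2.1 = 0 ∧ x.2.2.2.2 = 0}
  have hw := weight_le_height
  have t1 := summable_height_of_injOn P₁ (fun x => (x.1, x.2.2.1))
    (by
      rintro ⟨a, b, c, d, e⟩ ⟨h1, h2, h3⟩ ⟨a', b', c', d', e'⟩ ⟨h1', h2', h3'⟩ h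
      simp_all) (fun x => (hw x).1) (fun x => (hw x).2.2.1)
  have t2 := summable_height_of_injOn P₂ (fun x => (x.1, x.2.2.2.1))
    (by
      rintro ⟨a, b, c, d, e⟩ ⟨h1, h2, h3⟩ ⟨a', b', c', d', e'⟩ ⟨h1', h2', h3'⟩ h
      simp_all) (fun x => (hw x).1) (fun x => (hw x).2.2.2.1)
  have t3 := summable_height_of_injOn P₃ (fun x => (x.2.1, x.2.2.1))
    (by
      rintro ⟨a, b, c, d, e⟩ ⟨h1, h2, h3⟩ ⟨a', b', c', d', e'⟩ ⟨h1', h2', h3'⟩ h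
      simp_all) (fun x => (hw x).2.1) (fun x => (hw x).2.2.1)
  have t4 := summable_height_of_injOn P₄ (fun x => (x.2.1, x.2.2.2.1))
    (by
      rintro ⟨a, b, c, d, e⟩ ⟨h1, h2, h3⟩ ⟨a', b', c', d', e'⟩ ⟨h1', h2', h3'⟩ h
      simp_all) (fun x => (hw x).2.1) (fun x => (hw x).2.2.2.1)
  refine Summable.of_nonneg_of_le (fun x => Set.indicator_nonneg (fun x _ => hf0 x) x)
    (fun x => ?_) (s1.add (s2.add (t1.add (t2.add (t3.add t4)))))
  have nn : ∀ (T : Set Point) (y : Point), 0 ≤ T.indicator f y := fun T y =>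
    Set.indicator_nonneg (fun x _ => hf0 x) y
  have n1 := nn ({x | x.1 ≠ 0 ∧ x.2.1 ≠ 0} ∩ quadric) x
  have n2 := nn ({x | x.1 ≠ 0 ∧ x.2.1 ≠ 0} ∩ quadric) (σ x)
  have n3 := nn P₁ x
  have n4 := nn P₂ x
  have n5 := nn P₃ x
  have n6 := nn P₄ x
  have hσ : f (σ x) = f x := by
    obtain ⟨a, b, c, d, e⟩ := x
    have : height (σ (a, b, c, d, e)) = height (a, b, c, d, e) := by
      simp only [height, σ, Equiv.coe_fn_mk]
      ac_rfl
    simp only [hf, this]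
  have key : ∀ (T : Set Point), x ∈ T → f x ≤ T.indicator f x := fun T hx => by
    rw [Set.indicator_of_mem hx]
  by_cases hx : x ∈ quadric
  swap
  · rw [Set.indicator_of_notMem hx]
    simp only [Function.comp_apply]
    positivity
  rw [Set.indicator_of_mem hx]
  simp only [Function.comp_apply]
  have hq := hx
  by_cases h1 : x.1 ≠ 0 ∧ x.2.1 ≠ 0
  · linarith [key _ (show x ∈ {x | x.1 ≠ 0 ∧ x.2.1 ≠ 0} ∩ quadric from ⟨h1, hx⟩)]
  by_cases h2 : x.2.2.1 ≠ 0 ∧ x.2.2.2.1 ≠ 0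
  · have h3 : σ x ∈ {x | x.1 ≠ 0 ∧ x.2.1 ≠ 0} ∩ quadric := by
      refine ⟨h2, ?_⟩
      simp only [quadric, Set.mem_ofPred_eq, σ, Equiv.coe_fn_mk] at hx ⊢
      linear_combination hx
    have : f x = Set.indicator ({x | x.1 ≠ 0 ∧ x.2.1 ≠ 0} ∩ quadric) f (σ x) := by
      rw [Set.indicator_of_mem h3, hσ]
    linarith
  have e0 : x.2.2.2.2 = 0 := by
    have h3 : x.1 * x.2.1 = 0 := by
      rw [mul_eq_zero]
      tauto
    have h4 : x.2.2.1 * x.2.2.2.1 = 0 := by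
      rw [mul_eq_zero]
      tauto
    simp only [quadric, Set.mem_ofPred_eq] at hx
    have : x.2.2.2.2 ^ 2 = 0 := by linear_combination hx - h3 - h4
    simpa using this
  by_cases ha : x.1 = 0 <;> by_cases hc : x.2.2.1 = 0
  · linarith [key P₄ ⟨ha, hc, e0⟩]
  · linarith [key P₃ ⟨ha, by tauto, e0⟩]
  · linarith [key P₂ ⟨by tauto, hc, e0⟩]
  · linarith [key P₁ ⟨by tauto, by tauto, e0⟩]

end SiegelEis

/-! ### Plücker coordinates and absolute convergence. -/

namespace SiegelEis

open scoped Matrix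
open Asymptotics Filter

/-- The block `A` of `(A, B; C, D)`. -/
def blockA (γ : Sp4Z) : Matrix (Fin 2) (Fin 2) ℤ := γ.1.toBlocks₁₁

/-- The block `B` of `(A, B; C, D)`. -/
def blockB (γ : Sp4Z) : Matrix (Fin 2) (Fin 2) ℤ := γ.1.toBlocks₁₂

theorem fromBlocks_eq (γ : Sp4Z) :
    Matrix.fromBlocks (blockA γ) (blockB γ) (blockC γ) (blockD γ) = γ.1 :=
  Matrix.fromBlocks_toBlocks γ.1

theorem blockA_transpose_mul_blockC (γ : Sp4Z) : (blockA γ)ᵀ * blockC γ = (blockC γ)ᵀ * blockA γ :=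
  (SymplecticGroup.fromBlocks_mem_iff.1 ((fromBlocks_eq γ).symm ▸ γ.2)).1

theorem block_transpose_relations (γ : Sp4Z) :
    blockC γ * (blockD γ)ᵀ = blockD γ * (blockC γ)ᵀ ∧
      blockA γ * (blockD γ)ᵀ - blockB γ * (blockC γ)ᵀ = 1 := by
  have h := SymplecticGroup.transpose_mem γ.2
  rw [← fromBlocks_eq γ, Matrix.fromBlocks_transpose, SymplecticGroup.fromBlocks_mem_iff] at h
  simpa using h.2

theorem blockA_mul (γ δ : Sp4Z) :
    blockA (γ * δ) = blockA γ * blockA δ + blockB γ * blockC δ := by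
  ext i j
  simp [blockA, blockB, blockC, Matrix.toBlocks₂₁, Matrix.toBlocks₁₁, Matrix.toBlocks₁₂,
    Matrix.mul_apply]

theorem blockA_inv (γ : Sp4Z) : blockA γ⁻¹ = (blockD γ)ᵀ := by
  ext i j
  simp [blockA, blockD, Matrix.toBlocks₁₁, Matrix.toBlocks₂₂, SymplecticGroup.coe_inv, Matrix.J,
    Matrix.mul_apply, Matrix.fromBlocks, Matrix.one_apply]

theorem blockC_mul_inv (γ δ : Sp4Z) :
    blockC (γ * δ⁻¹) = blockC γ * (blockD δ)ᵀ - blockD γ * (blockC δ)ᵀ := by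
  rw [blockC_mul, blockC_inv, ← blockA, blockA_inv, Matrix.mul_neg, sub_eq_add_neg]

/-- The rows of the matrix `(C, D)`. -/
def row (γ : Sp4Z) (i : Fin 2) : Fin 4 → ℤ :=
  ![blockC γ i 0, blockC γ i 1, blockD γ i 0, blockD γ i 1]

/-- The `2 × 2` minors of the matrix with rows `r` and `s`. -/
def minor (r s : Fin 4 → ℤ) (i j : Fin 4) : ℤ := r i * s j - r j * s i

/-- The standard symplectic form. -/
def symplecticForm (r s : Fin 4 → ℤ) : ℤ := r 0 * s 2 - r 2 * s 0 + r 1 * s 3 - r 3 * s 1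

theorem symplecticForm_row (γ : Sp4Z) : symplecticForm (row γ 0) (row γ 1) = 0 := by
  have h := congrFun (congrFun (block_transpose_relations γ).1 0) 1
  simp only [Matrix.mul_apply, Fin.sum_univ_two, Matrix.transpose_apply] at h
  simp [symplecticForm, row]
  linear_combination h

theorem exists_minor_ne_zero (γ : Sp4Z) : ∃ i j, minor (row γ 0) (row γ 1) i j ≠ 0 := by
  by_contra! h
  have e := (block_transpose_relations γ).2
  have e00 := congrFun (congrFun e 0) 0
  have e01 := congrFun (congrFun e 0) 1
  have e10 := congrFun (congrFun e 1) 0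
  have e11 := congrFun (congrFun e 1) 1
  simp only [Matrix.sub_apply, Matrix.mul_apply, Fin.sum_univ_two, Matrix.transpose_apply,
    Matrix.one_apply, Fin.isValue, if_true, zero_ne_one, one_ne_zero, if_false] at e00 e01 e10 e11
  have h01 := h 0 1
  have h02 := h 0 2
  have h03 := h 0 3
  have h12 := h 1 2
  have h13 := h 1 3
  have h23 := h 2 3
  simp only [minor, row, Matrix.cons_val] at h01 h02 h03 h12 h13 h23
  generalize blockA γ 0 0 = a00, blockA γ 0 1 = a01, blockA γ 1 0 = a10, blockA γ 1 1 = a11,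
    blockB γ 0 0 = b00, blockB γ 0 1 = b01, blockB γ 1 0 = b10, blockB γ 1 1 = b11,
    blockC γ 0 0 = c00, blockC γ 0 1 = c01, blockC γ 1 0 = c10, blockC γ 1 1 = c11,
    blockD γ 0 0 = d00, blockD γ 0 1 = d01, blockD γ 1 0 = d10, blockD γ 1 1 = d11 at *
  -- Cauchy–Binet for `(-B, A) (C, D)ᵀ = 1`: the coefficients below are the minors of `(-B, A)`.
  have key : (1 : ℤ) = 0 := by
    calc (1 : ℤ) = (a00 * d00 + a01 * d01 - (b00 * c00 + b01 * c01)) *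
          (a10 * d10 + a11 * d11 - (b10 * c10 + b11 * c11)) -
          (a00 * d10 + a01 * d11 - (b00 * c10 + b01 * c11)) *
          (a10 * d00 + a11 * d01 - (b10 * c00 + b11 * c01)) := by
            rw [e00, e01, e10, e11]; norm_num
      _ = 0 := by
        linear_combination (b00 * b11 - b01 * b10) * h01 + (-b00 * a10 + a00 * b10) * h02 +
          (-b00 * a11 + a01 * b10) * h03 + (-b01 * a10 + a00 * b11) * h12 +
          (-b01 * a11 + a01 * b11) * h13 + (a00 * a11 - a01 * a10) * h23
  exact one_ne_zero key

/-- The last hypothesis says that 3 × 3 minors of the rows `x, r₀, r₁` vanish. As one minor of `r₀,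
r₁` is nonzero, `x` lies in their span, which is isotropic. -/
theorem symplecticForm_eq_zero {r₀ r₁ x : Fin 4 → ℤ} (hr : symplecticForm r₀ r₁ = 0)
    {j k : Fin 4} (hjk : minor r₀ r₁ j k ≠ 0)
    (h : ∀ i, x i * minor r₀ r₁ j k - x j * minor r₀ r₁ i k + x k * minor r₀ r₁ i j = 0) :
    symplecticForm x r₀ = 0 ∧ symplecticForm x r₁ = 0 := by
  have h0 := h 0
  have h1 := h 1
  have h2 := h 2
  have h3 := h 3
  constructor <;> refine (mul_eq_zero.1 ?_).resolve_left hjk <;>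
    simp only [symplecticForm, minor] at *
  · linear_combination r₀ 2 * h0 - r₀ 0 * h2 + r₀ 3 * h1 - r₀ 1 * h3 +
      (x j * r₀ k - x k * r₀ j) * hr
  · linear_combination r₁ 2 * h0 - r₁ 0 * h2 + r₁ 3 * h1 - r₁ 1 * h3 +
      (x j * r₁ k - x k * r₁ j) * hr

/-- The Plücker coordinates of the Lagrangian plane spanned by the rows of `(C, D)`. -/
def plucker (γ : Sp4Z) : Point :=
  (minor (row γ 0) (row γ 1) 0 1, minor (row γ 0) (row γ 1) 2 3, minor (row γ 0) (row γ 1) 0 3,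
    minor (row γ 0) (row γ 1) 1 2, minor (row γ 0) (row γ 1) 0 2)

/-- Isotropy of the rows makes the omitted minor `(1, 3)` the negative of `(0, 2)`; the Plücker
relation then becomes the equation of the quadric. -/
theorem plucker_mem_quadric (γ : Sp4Z) : plucker γ ∈ quadric := by
  have h := symplecticForm_row γ
  simp only [quadric, Set.mem_ofPred_eq, plucker, minor, symplecticForm] at h ⊢
  linear_combination (row γ 0 0 * row γ 1 2 - row γ 0 2 * row γ 1 0) * h

theorem minor_eq_of_plucker_eq {γ δ : Sp4Z} (h : plucker γ = plucker δ) (i j : Fin 4) :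
    minor (row γ 0) (row γ 1) i j = minor (row δ 0) (row δ 1) i j := by
  simp only [plucker, Prod.mk.injEq] at h
  obtain ⟨h01, h23, h03, h12, h02⟩ := h
  have hγ := symplecticForm_row γ
  have hδ := symplecticForm_row δ
  simp only [symplecticForm, minor] at *
  fin_cases i <;> fin_cases j <;> simp only [Fin.reduceFinMk, Fin.zero_eta, Fin.mk_one, sub_self]
  all_goals first
    | ring1
    | linear_combination h01
    | linear_combination -h01
    | linear_combination h23
    | linear_combination -h23
    | linear_combination h03
    | linear_combination -h03
    | linear_combination h12
    | linear_combination -h12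
    | linear_combination h02
    | linear_combination -h02
    | linear_combination hγ - hδ - h02
    | linear_combination h02 - hγ + hδ

/-- Equal minors mean equal Lagrangian planes, so the rows of `γ` pair to zero with those of `δ`.
These pairings are the entries of the lower-left block of `γ * δ⁻¹`. -/
theorem mul_inv_mem_GammaInf {γ δ : Sp4Z} (h : plucker γ = plucker δ) : γ * δ⁻¹ ∈ GammaInf := by
  obtain ⟨j, k, hjk⟩ := exists_minor_ne_zero δ
  have hm := minor_eq_of_plucker_eq h
  have h0 := symplecticForm_eq_zero (x := row γ 0) (symplecticForm_row δ) hjk fun i => by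
    rw [← hm, ← hm, ← hm]; simp only [minor]; ring
  have h1 := symplecticForm_eq_zero (x := row γ 1) (symplecticForm_row δ) hjk fun i => by
    rw [← hm, ← hm, ← hm]; simp only [minor]; ring
  change blockC (γ * δ⁻¹) = 0
  rw [blockC_mul_inv]
  simp only [symplecticForm, row, Matrix.cons_val] at h0 h1
  ext i j
  simp only [Matrix.sub_apply, Matrix.mul_apply, Fin.sum_univ_two, Matrix.transpose_apply,
    Matrix.zero_apply]
  fin_cases i <;> fin_cases j <;> simp only [Fin.zero_eta, Fin.mk_one]
  · linear_combination h0.1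
  · linear_combination h0.2
  · linear_combination h1.1
  · linear_combination h1.2

theorem plucker_out_injective : Function.Injective fun c : Cosets => plucker c.out := by
  intro c c' h
  rw [← Quotient.out_eq c, ← Quotient.out_eq c']
  refine Quotient.sound ?_
  change QuotientGroup.rightRel GammaInf _ _
  rw [QuotientGroup.rightRel_apply]
  exact mul_inv_mem_GammaInf h.symm

/-- The linear form in the Plücker coordinates with value `det (C Z + D)`. -/
noncomputable def pluckerForm (Z : UpperHalf) (x : Point) : ℂ :=
  x.1 * (Z.1 0 0 * Z.1 1 1 - Z.1 0 1 ^ 2) + x.2.1 + x.2.2.1 * Z.1 0 0 - x.2.2.2.1 * Z.1 1 1 -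
    2 * x.2.2.2.2 * Z.1 0 1

theorem autFactor_eq_pluckerForm (γ : Sp4Z) (Z : UpperHalf) :
    autFactor γ Z = pluckerForm Z (plucker γ) := by
  have hs : Z.1 1 0 = Z.1 0 1 := Z.2.1.apply 0 1
  have h : (symplecticForm (row γ 0) (row γ 1) : ℂ) = 0 := by
    rw [symplecticForm_row, Int.cast_zero]
  simp only [symplecticForm, row, Matrix.cons_val] at h
  push_cast at h
  simp only [autFactor, pluckerForm, plucker, minor, row, Matrix.det_fin_two, Matrix.add_apply,
    Matrix.mul_apply, Fin.sum_univ_two, Matrix.map_apply, hs, Matrix.cons_val]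
  push_cast
  linear_combination Z.1 0 1 * h

/-- `‖L‖²` alone is only semidefinite, but on the quadric one may add `4Δ(ab + cd + e²) = 0`, which
makes it positive definite. The squares in the two expressions give five independent linear forms
that are `O(L)`; solving for the coordinates finishes. -/
theorem isBigO_of_quadric_eq_zero {X : Type*} {S : Set X} {L : X → ℂ} {a b c d e : X → ℝ}
    {y₁ y₂ y₃ Δ : ℝ} (hy₁ : 0 < y₁) (hΔd : Δ = y₁ * y₃ - y₂ ^ 2) (hΔ : 0 < Δ)
    (hq : ∀ x ∈ S, a x * b x + c x * d x + e x ^ 2 = 0)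
    (hnorm : ∀ x, ‖L x‖ ^ 2 = (b x - a x * Δ) ^ 2 +
      (c x * y₁ - d x * y₃ - 2 * e x * y₂) ^ 2) :
    a =O[𝓟 S] L ∧ b =O[𝓟 S] L ∧ c =O[𝓟 S] L ∧ d =O[𝓟 S] L ∧ e =O[𝓟 S] L := by
  have of_sq : ∀ (f : X → ℝ) (K : ℝ), (∀ x ∈ S, f x ^ 2 ≤ K ^ 2 * ‖L x‖ ^ 2) →
      f =O[𝓟 S] L := by
    intro f K h
    rw [isBigO_principal]
    refine ⟨|K|, fun x hx => ?_⟩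
    rw [Real.norm_eq_abs]
    refine abs_le_of_sq_le_sq' ?_ (by positivity) |> abs_le.2
    rw [mul_pow, sq_abs]
    exact h x hx
  have o₁ : (fun x => b x - a x * Δ) =O[𝓟 S] L := of_sq _ 1 fun x _ => by
    nlinarith [hnorm x, sq_nonneg (c x * y₁ - d x * y₃ - 2 * e x * y₂)]
  have o₂ : (fun x => c x * y₁ - d x * y₃ - 2 * e x * y₂) =O[𝓟 S] L := of_sq _ 1 fun x _ => by
    nlinarith [hnorm x, sq_nonneg (b x - a x * Δ)]
  -- the positive definite form `‖L‖² + 4 Δ (ab + cd + e²)` as a sum of squares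
  have hsum : ∀ x ∈ S, ‖L x‖ ^ 2 = (b x + a x * Δ) ^ 2 +
      (c x * y₁ + d x * (y₃ - 2 * y₂ ^ 2 / y₁) - 2 * e x * y₂) ^ 2 +
      4 * Δ * (e x + d x * (y₂ / y₁)) ^ 2 := by
    intro x hx
    rw [hnorm x, hΔd]
    have h := hq x hx
    have hy := hy₁.ne'
    field_simp
    linear_combination (-(4 * (y₁ * y₃ - y₂ ^ 2) * y₁ ^ 2)) * h
  have o₃ : (fun x => b x + a x * Δ) =O[𝓟 S] L := of_sq _ 1 fun x hx => by
    have := hsum x hx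
    have : 0 ≤ 4 * Δ * (e x + d x * (y₂ / y₁)) ^ 2 := by positivity
    nlinarith [sq_nonneg (c x * y₁ + d x * (y₃ - 2 * y₂ ^ 2 / y₁) - 2 * e x * y₂)]
  have o₄ : (fun x => c x * y₁ + d x * (y₃ - 2 * y₂ ^ 2 / y₁) - 2 * e x * y₂) =O[𝓟 S] L :=
    of_sq _ 1 fun x hx => by
      have := hsum x hx
      have : 0 ≤ 4 * Δ * (e x + d x * (y₂ / y₁)) ^ 2 := by positivity
      nlinarith [sq_nonneg (b x + a x * Δ)]
  have o₅ : (fun x => e x + d x * (y₂ / y₁)) =O[𝓟 S] L := by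
    have h1 : (fun x => 2 * Real.sqrt Δ * (e x + d x * (y₂ / y₁))) =O[𝓟 S] L :=
      of_sq _ 1 fun x hx => by
        have := hsum x hx
        rw [mul_pow, mul_pow, Real.sq_sqrt hΔ.le]
        nlinarith [sq_nonneg (b x + a x * Δ),
          sq_nonneg (c x * y₁ + d x * (y₃ - 2 * y₂ ^ 2 / y₁) - 2 * e x * y₂)]
    exact (isBigO_const_mul_left_iff (by positivity)).1 h1
  have oa : a =O[𝓟 S] L := by
    refine ((o₃.sub o₁).const_mul_left (2 * Δ)⁻¹).congr_left fun x => ?_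
    field_simp
    ring
  have ob : b =O[𝓟 S] L :=
    ((o₃.add o₁).const_mul_left 2⁻¹).congr_left fun x => by ring
  have od : d =O[𝓟 S] L := by
    refine ((o₄.sub o₂).const_mul_left (2 * Δ / y₁)⁻¹).congr_left fun x => ?_
    have hy := hy₁.ne'
    have hΔ' := hΔ.ne'
    rw [inv_mul_eq_iff_eq_mul₀ (by positivity), hΔd]
    field_simp
    ring
  have oe : e =O[𝓟 S] L :=
    (o₅.sub (od.const_mul_left (y₂ / y₁))).congr_left fun x => by ring
  have oc : c =O[𝓟 S] L := by
    refine (((o₂.add (od.const_mul_left y₃)).add (oe.const_mul_left (2 * y₂))).const_mul_left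
      y₁⁻¹).congr_left fun x => ?_
    field_simp
    ring
  exact ⟨oa, ob, oc, od, oe⟩

/-- Translation by the real part of `Z` acts linearly on the coordinates and preserves the quadric,
reducing to purely imaginary `Z` with `Δ = det (Im Z) > 0`. -/
theorem pluckerForm_isBigO (Z : UpperHalf) :
    (fun x : Point => (x.1 : ℝ)) =O[𝓟 quadric] pluckerForm Z ∧
    (fun x : Point => (x.2.1 : ℝ)) =O[𝓟 quadric] pluckerForm Z ∧
    (fun x : Point => (x.2.2.1 : ℝ)) =O[𝓟 quadric] pluckerForm Z ∧
    (fun x : Point => (x.2.2.2.1 : ℝ)) =O[𝓟 quadric] pluckerForm Z ∧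
    (fun x : Point => (x.2.2.2.2 : ℝ)) =O[𝓟 quadric] pluckerForm Z := by
  obtain ⟨Z, hsymm, hpos⟩ := Z
  have hy₁ : 0 < (Z 0 0).im := by simpa using hpos.diag_pos (i := 0)
  have hs : Z 1 0 = Z 0 1 := hsymm.apply 0 1
  have hΔ : 0 < (Z 0 0).im * (Z 1 1).im - (Z 0 1).im ^ 2 := by
    have := hpos.det_pos
    rw [Matrix.det_fin_two] at this
    simp only [Matrix.map_apply, hs] at this
    linarith
  set x₁ := (Z 0 0).re with hx₁
  set x₂ := (Z 0 1).re with hx₂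
  set x₃ := (Z 1 1).re with hx₃
  set y₁ := (Z 0 0).im with hy₁d
  set y₂ := (Z 0 1).im with hy₂d
  set y₃ := (Z 1 1).im with hy₃d
  set Δ := y₁ * y₃ - y₂ ^ 2 with hΔd
  set L := pluckerForm ⟨Z, hsymm, hpos⟩ with hL
  -- coordinates after the translation by the real part of `Z`
  let a : Point → ℝ := fun x => x.1
  let b : Point → ℝ := fun x => x.1 * (x₁ * x₃ - x₂ ^ 2) + x.2.1 + x.2.2.1 * x₁ -
    x.2.2.2.1 * x₃ - 2 * x.2.2.2.2 * x₂
  let c : Point → ℝ := fun x => x.2.2.1 + x.1 * x₃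
  let d : Point → ℝ := fun x => x.2.2.2.1 - x.1 * x₁
  let e : Point → ℝ := fun x => x.2.2.2.2 + x.1 * x₂
  have hq : ∀ x ∈ quadric, a x * b x + c x * d x + e x ^ 2 = 0 := by
    intro x hx
    have : ((x.1 * x.2.1 + x.2.2.1 * x.2.2.2.1 + x.2.2.2.2 ^ 2 : ℤ) : ℝ) = 0 := by
      rw [show x.1 * x.2.1 + x.2.2.1 * x.2.2.2.1 + x.2.2.2.2 ^ 2 = 0 from hx, Int.cast_zero]
    push_cast at this
    simp only [a, b, c, d, e]
    linear_combination this
  have hnorm : ∀ x, ‖L x‖ ^ 2 = (b x - a x * Δ) ^ 2 +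
      (c x * y₁ - d x * y₃ - 2 * e x * y₂) ^ 2 := by
    intro x
    have hre : (L x).re = b x - a x * Δ := by
      simp [L, pluckerForm, pow_two, a, b, hΔd, ← hx₁, ← hx₂, ← hx₃, ← hy₁d, ← hy₂d, ← hy₃d]
      ring
    have him : (L x).im = c x * y₁ - d x * y₃ - 2 * e x * y₂ := by
      simp [L, pluckerForm, pow_two, c, d, e, ← hx₁, ← hx₂, ← hx₃, ← hy₁d, ← hy₂d, ← hy₃d]
      ring
    rw [Complex.sq_norm, Complex.normSq_apply, hre, him]
    ring
  obtain ⟨oa, ob, oc, od, oe⟩ := isBigO_of_quadric_eq_zero hy₁ hΔd hΔ hq hnorm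
  have oc' : (fun x : Point => (x.2.2.1 : ℝ)) =O[𝓟 quadric] L :=
    (oc.sub (oa.const_mul_left x₃)).congr_left fun x => by simp only [a, c]; ring
  have od' : (fun x : Point => (x.2.2.2.1 : ℝ)) =O[𝓟 quadric] L :=
    (od.add (oa.const_mul_left x₁)).congr_left fun x => by simp only [a, d]; ring
  have oe' : (fun x : Point => (x.2.2.2.2 : ℝ)) =O[𝓟 quadric] L :=
    (oe.sub (oa.const_mul_left x₂)).congr_left fun x => by simp only [a, e]; ring
  refine ⟨oa, ?_, oc', od', oe'⟩
  refine ((((ob.sub (oa.const_mul_left (x₁ * x₃ - x₂ ^ 2))).sub (oc'.const_mul_left x₁)).add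
    (od'.const_mul_left x₃)).add (oe'.const_mul_left (2 * x₂))).congr_left fun x => ?_
  simp only [a, b]
  ring

theorem plucker_ne_zero (γ : Sp4Z) : plucker γ ≠ 0 := by
  intro h
  obtain ⟨i, j, hij⟩ := exists_minor_ne_zero γ
  simp only [plucker, Prod.mk_eq_zero] at h
  obtain ⟨h01, h23, h03, h12, h02⟩ := h
  have hγ := symplecticForm_row γ
  apply hij
  simp only [symplecticForm, minor] at *
  clear hij
  fin_cases i <;> fin_cases j <;> simp only [Fin.reduceFinMk, Fin.zero_eta, Fin.mk_one]
  all_goals first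
    | linear_combination h01
    | linear_combination -h01
    | linear_combination h23
    | linear_combination -h23
    | linear_combination h03
    | linear_combination -h03
    | linear_combination h12
    | linear_combination -h12
    | linear_combination h02
    | linear_combination -h02
    | linear_combination hγ - h02
    | linear_combination h02 - hγ
    | ring

theorem exists_height_le (Z : UpperHalf) : ∃ K : ℝ, 0 < K ∧
    ∀ γ : Sp4Z, height (plucker γ) ≤ K * ‖autFactor γ Z‖ := by
  obtain ⟨o₁, o₂, o₃, o₄, o₅⟩ := pluckerForm_isBigO Z
  have ho := ((((o₁.norm_left.add o₂.norm_left).add o₃.norm_left).add o₄.norm_left).add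
    o₅.norm_left)
  rw [isBigO_principal] at ho
  obtain ⟨K, hK⟩ := ho
  refine ⟨max K 1, by positivity, fun γ => ?_⟩
  have h := hK _ (plucker_mem_quadric γ)
  have hne := plucker_ne_zero γ
  rw [autFactor_eq_pluckerForm]
  generalize plucker γ = x at *
  obtain ⟨a, b, c, d, e⟩ := x
  simp only [Real.norm_eq_abs] at h
  have h' : |(a : ℝ)| + |(b : ℝ)| + |(c : ℝ)| + |(d : ℝ)| + |(e : ℝ)| ≤
      max K 1 * ‖pluckerForm Z (a, b, c, d, e)‖ := by
    rw [abs_of_nonneg (by positivity)] at h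
    exact h.trans (by gcongr; exact le_max_left _ _)
  refine le_trans ?_ h'
  have key : ∀ n : ℤ, n ≠ 0 → (1 : ℝ) ≤ |(n : ℝ)| := fun n hn => by
    exact_mod_cast Int.one_le_abs hn
  have na := abs_nonneg (a : ℝ)
  have nb := abs_nonneg (b : ℝ)
  have nc := abs_nonneg (c : ℝ)
  have nd := abs_nonneg (d : ℝ)
  have ne := abs_nonneg (e : ℝ)
  -- Integrality: a nonzero point has a coordinate of absolute value at least 1, so the truncation
  -- in `height` costs nothing.
  have h1 : (1 : ℝ) ≤ |(a : ℝ)| + |(b : ℝ)| + |(c : ℝ)| + |(d : ℝ)| + |(e : ℝ)| := by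
    by_contra! hlt
    have ha : a = 0 := by by_contra h0; linarith [key a h0]
    have hb : b = 0 := by by_contra h0; linarith [key b h0]
    have hc : c = 0 := by by_contra h0; linarith [key c h0]
    have hd : d = 0 := by by_contra h0; linarith [key d h0]
    have he : e = 0 := by by_contra h0; linarith [key e h0]
    exact hne (by rw [ha, hb, hc, hd, he]; rfl)
  simp only [height, weight, max_le_iff]
  refine ⟨⟨h1, ?_⟩, ⟨h1, ?_⟩, ⟨h1, ?_⟩, ⟨h1, ?_⟩, h1, ?_⟩ <;> linarith

/-- The Siegel Eisenstein series of degree two converges absolutely for weights `k ≥ 4`. -/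
theorem summable_eisTerm {k : ℕ} (hk : 4 ≤ k) (Z : UpperHalf) :
    Summable fun c : Cosets => eisTerm k Z c := by
  obtain ⟨K, hK0, hK⟩ := exists_height_le Z
  have hs := (summable_height.comp_injective plucker_out_injective).mul_left (K ^ k)
  refine Summable.of_norm_bounded hs fun c => ?_
  have hmem := plucker_mem_quadric c.out
  simp only [Function.comp_apply]
  rw [Set.indicator_of_mem hmem, eisTerm, norm_zpow, zpow_neg, zpow_natCast]
  have h := hK c.out
  have h1 := one_le_height (plucker c.out)
  have hn : 0 < ‖autFactor c.out Z‖ := by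
    by_contra! h0
    nlinarith
  rw [inv_le_iff_one_le_mul₀ (by positivity), mul_right_comm, ← mul_pow,
    ← div_eq_mul_inv, one_le_div (by positivity)]
  calc height (plucker c.out) ^ 4 ≤ height (plucker c.out) ^ k := pow_le_pow_right₀ h1 hk
    _ ≤ _ := by gcongr

end SiegelEis

/-! ### Strong approximation for `SL₂(ℤ)`. -/

namespace SiegelEis

open scoped Matrix
open Matrix

section Lifting

variable {P : Finset ℕ}

theorem exists_intCast_eq (hP : ∀ q ∈ P, q.Prime) (t : ∀ q : ℕ, ZMod q) :
    ∃ x : ℤ, ∀ q ∈ P, (x : ZMod q) = t q := by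
  obtain ⟨k, hk⟩ := Nat.chineseRemainderOfFinset (fun q => (t q).val) id P
    (fun q hq => (hP q hq).ne_zero)
    (fun q hq r hr hqr => (Nat.coprime_primes (hP q hq) (hP r hr)).2 hqr)
  refine ⟨k, fun q hq => ?_⟩
  have : NeZero q := ⟨(hP q hq).ne_zero⟩
  have h := (ZMod.natCast_eq_natCast_iff _ _ _).2 (hk q hq)
  simpa using h

theorem exists_intCast_eq_single (hP : ∀ q ∈ P, q.Prime) {q : ℕ} (hq : q ∈ P) (x : ZMod q) :
    ∃ n : ℤ, (n : ZMod q) = x ∧ ∀ r ∈ P, r ≠ q → (n : ZMod r) = 0 := by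
  obtain ⟨n, hn⟩ := exists_intCast_eq hP (Function.update (fun r => (0 : ZMod r)) q x)
  refine ⟨n, by simpa using hn q hq, fun r hr hrq => ?_⟩
  rw [hn r hr, Function.update_of_ne hrq]

/-- The upper elementary matrix. -/
def upperElementary {R : Type*} [CommRing R] (x : R) : SpecialLinearGroup (Fin 2) R :=
  ⟨!![1, x; 0, 1], by simp [det_fin_two]⟩

/-- The lower elementary matrix. -/
def lowerElementary {R : Type*} [CommRing R] (x : R) : SpecialLinearGroup (Fin 2) R :=
  ⟨!![1, 0; x, 1], by simp [det_fin_two]⟩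

theorem coe_upperElementary {R : Type*} [CommRing R] (x : R) :
    (upperElementary x : Matrix (Fin 2) (Fin 2) R) = !![1, x; 0, 1] := rfl

theorem coe_lowerElementary {R : Type*} [CommRing R] (x : R) :
    (lowerElementary x : Matrix (Fin 2) (Fin 2) R) = !![1, 0; x, 1] := rfl

/-- Elementary matrices generate `SL₂` of a field. -/
theorem elementary_induction {F : Type*} [Field F] {p : SpecialLinearGroup (Fin 2) F → Prop}
    (hu : ∀ x, p (upperElementary x)) (hl : ∀ x, p (lowerElementary x))
    (hm : ∀ g h, p g → p h → p (g * h)) (g : SpecialLinearGroup (Fin 2) F) : p g := by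
  have main : ∀ g : SpecialLinearGroup (Fin 2) F, g.1 1 0 ≠ 0 → p g := by
    intro g hc
    have hdet := g.2
    rw [det_fin_two] at hdet
    have : g = upperElementary ((g.1 0 0 - 1) / g.1 1 0) *
        (lowerElementary (g.1 1 0) * upperElementary ((g.1 1 1 - 1) / g.1 1 0)) := by
      ext i j
      fin_cases i <;> fin_cases j <;>
        simp [coe_upperElementary, coe_lowerElementary, Matrix.mul_apply, Fin.sum_univ_two] <;>
        field_simp <;> first | ring1 | linear_combination -hdet
    rw [this]
    exact hm _ _ (hu _) (hm _ _ (hl _) (hu _))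
  by_cases hc : g.1 1 0 = 0
  · have hdet := g.2
    rw [det_fin_two, hc, mul_zero, sub_zero] at hdet
    have ha : g.1 0 0 ≠ 0 := left_ne_zero_of_mul_eq_one hdet
    -- If the lower-left entry vanishes, adding the first row to the second makes it the nonzero
    -- upper-left entry.
    have h1 : lowerElementary (-1 : F) * lowerElementary 1 = 1 := by
      ext i j
      fin_cases i <;> fin_cases j <;> simp [coe_lowerElementary]
    rw [show g = lowerElementary (-1) * (lowerElementary 1 * g) by
      rw [← mul_assoc, h1, one_mul]]
    refine hm _ _ (hl _) (main _ ?_)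
    simpa [coe_lowerElementary, Matrix.mul_apply, Fin.sum_univ_two, hc] using ha
  · exact main g hc

/-- Reduction of `SL₂(ℤ)` modulo `q`. -/
abbrev reduceSL (q : ℕ) :
    SpecialLinearGroup (Fin 2) ℤ →* SpecialLinearGroup (Fin 2) (ZMod q) :=
  SpecialLinearGroup.map (Int.castRingHom (ZMod q))

theorem reduceSL_upperElementary (q : ℕ) (n : ℤ) :
    reduceSL q (upperElementary n) = upperElementary (n : ZMod q) := by
  ext i j
  fin_cases i <;> fin_cases j <;> simp [coe_upperElementary]

theorem reduceSL_lowerElementary (q : ℕ) (n : ℤ) :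
    reduceSL q (lowerElementary n) = lowerElementary (n : ZMod q) := by
  ext i j
  fin_cases i <;> fin_cases j <;> simp [coe_lowerElementary]

theorem upperElementary_zero {R : Type*} [CommRing R] : upperElementary (0 : R) = 1 := by
  ext i j
  fin_cases i <;> fin_cases j <;> simp [coe_upperElementary]

theorem lowerElementary_zero {R : Type*} [CommRing R] : lowerElementary (0 : R) = 1 := by
  ext i j
  fin_cases i <;> fin_cases j <;> simp [coe_lowerElementary]

/-- Elementary matrices lift by lifting their entry with the Chinese remainder theorem, taking it to
be 0 at the other primes; products preserve the property. -/
theorem exists_reduceSL_eq_single (hP : ∀ q ∈ P, q.Prime) {q : ℕ} (hq : q ∈ P)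
    (g : SpecialLinearGroup (Fin 2) (ZMod q)) :
    ∃ U, reduceSL q U = g ∧ ∀ r ∈ P, r ≠ q → reduceSL r U = 1 := by
  have : Fact q.Prime := ⟨hP q hq⟩
  refine elementary_induction
    (p := fun g => ∃ U, reduceSL q U = g ∧ ∀ r ∈ P, r ≠ q → reduceSL r U = 1) (fun x => ?_) (fun x => ?_) ?_ g
  · obtain ⟨n, hn, hn'⟩ := exists_intCast_eq_single hP hq x
    refine ⟨upperElementary n, by rw [reduceSL_upperElementary, hn], fun r hr hrq => ?_⟩
    rw [reduceSL_upperElementary, hn' r hr hrq, upperElementary_zero]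
  · obtain ⟨n, hn, hn'⟩ := exists_intCast_eq_single hP hq x
    refine ⟨lowerElementary n, by rw [reduceSL_lowerElementary, hn], fun r hr hrq => ?_⟩
    rw [reduceSL_lowerElementary, hn' r hr hrq, lowerElementary_zero]
  · rintro g h ⟨U, hU, hU'⟩ ⟨V, hV, hV'⟩
    refine ⟨U * V, by rw [map_mul, hU, hV], fun r hr hrq => ?_⟩
    rw [map_mul, hU' r hr hrq, hV' r hr hrq, one_mul]

/-- Strong approximation for `SL₂(ℤ)` at finitely many primes. -/
theorem exists_reduceSL_eq (hP : ∀ q ∈ P, q.Prime)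
    (u : ∀ q : ℕ, SpecialLinearGroup (Fin 2) (ZMod q)) :
    ∃ U, ∀ q ∈ P, reduceSL q U = u q := by
  have key : ∀ Q : Finset ℕ, Q ⊆ P →
      ∃ U, ∀ q ∈ P, reduceSL q U = if q ∈ Q then u q else 1 := by
    intro Q
    induction Q using Finset.induction_on with
    | empty => exact fun _ => ⟨1, fun q _ => by simp⟩
    | insert q Q hqQ ih =>
      intro hQ
      obtain ⟨U, hU⟩ := ih fun x hx => hQ (Finset.mem_insert_of_mem hx)
      obtain ⟨V, hV, hV'⟩ := exists_reduceSL_eq_single hP (hQ (Finset.mem_insert_self q Q)) (u q)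
      refine ⟨U * V, fun r hr => ?_⟩
      rw [map_mul, hU r hr]
      by_cases hrq : r = q
      · subst hrq
        rw [if_neg hqQ, hV, one_mul, if_pos (Finset.mem_insert_self _ _)]
      · rw [hV' r hr hrq, mul_one]
        simp [Finset.mem_insert, hrq]
  obtain ⟨U, hU⟩ := key P subset_rfl
  exact ⟨U, fun q hq => by rw [hU q hq, if_pos hq]⟩

end Lifting

/-! ### Normal forms over a field. -/

section Local

variable {F : Type*} [Field F]

/-- The symmetric matrix with entries `s 0`, `s 1`, `s 2`. -/
def symMatrix {R : Type*} (s : Fin 3 → R) : Matrix (Fin 2) (Fin 2) R := !![s 0, s 1; s 1, s 2]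

theorem exists_clear_second_row {C : Matrix (Fin 2) (Fin 2) F} (hdet : C.det = 0) :
    ∃ u : SpecialLinearGroup (Fin 2) F, (u.1 * C) 1 = 0 := by
  rw [det_fin_two] at hdet
  by_cases h0 : C 0 0 = 0
  · by_cases h1 : C 0 1 = 0
    · refine ⟨⟨!![0, 1; -1, 0], by simp [det_fin_two]⟩, ?_⟩
      ext j
      fin_cases j <;> simp [Matrix.mul_apply, Fin.sum_univ_two, h0, h1]
    · refine ⟨lowerElementary (-(C 1 1 / C 0 1)), ?_⟩
      ext j
      fin_cases j <;> simp [coe_lowerElementary, Matrix.mul_apply, Fin.sum_univ_two, h1, h0]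
      grind
  · refine ⟨lowerElementary (-(C 1 0 / C 0 0)), ?_⟩
    ext j
    fin_cases j <;> simp [coe_lowerElementary, Matrix.mul_apply, Fin.sum_univ_two, h0]
    field_simp
    linear_combination hdet

/-- Once `u` clears the second row of `C`, the symmetry relation forces the first row of `A` to be a
multiple `l` of that of `C`. The shear with upper-left entry `1 - l` then makes these first rows
equal. -/
theorem exists_local_rank_one {A C : Matrix (Fin 2) (Fin 2) F} (hs : Aᵀ * C = Cᵀ * A)
    (hC : C ≠ 0) (hdet : C.det = 0) :
    ∃ (u : SpecialLinearGroup (Fin 2) F) (s : Fin 3 → F), u.1 * C =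
      !![1, 0; 0, 0] * (u.1.adjugateᵀ * A + symMatrix s * (u.1 * C)) := by
  obtain ⟨u, hu⟩ := exists_clear_second_row hdet
  set A' := u.1.adjugateᵀ * A with hA'
  set C' := u.1 * C with hC'
  have hCC : C = u.1.adjugate * C' := by
    rw [hC', ← Matrix.mul_assoc, adjugate_mul, u.2, one_smul, Matrix.one_mul]
  have hs' : A'ᵀ * C' = C'ᵀ * A' := by
    have h1 : A'ᵀ * C' = Aᵀ * C := by
      rw [hA', hC', transpose_mul, transpose_transpose, Matrix.mul_assoc,
        ← Matrix.mul_assoc _ u.1, adjugate_mul, u.2, one_smul, Matrix.one_mul]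
    rw [h1, hs, ← transpose_transpose (Cᵀ * A), transpose_mul, transpose_transpose, ← h1,
      transpose_mul, transpose_transpose]
  have h10 : C' 1 0 = 0 := congrFun hu 0
  have h11 : C' 1 1 = 0 := congrFun hu 1
  have hrel := congrFun (congrFun hs' 0) 1
  simp only [Matrix.mul_apply, Fin.sum_univ_two, transpose_apply, h10, h11, mul_zero, zero_mul,
    add_zero] at hrel
  have hne : C' 0 0 ≠ 0 ∨ C' 0 1 ≠ 0 := by
    by_contra! h
    apply hC
    rw [hCC]
    have : C' = 0 := by
      ext i j
      fin_cases i <;> fin_cases j <;> simp [h.1, h.2, h10, h11]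
    rw [this, Matrix.mul_zero]
  obtain ⟨l, hl0, hl1⟩ : ∃ l, A' 0 0 = l * C' 0 0 ∧ A' 0 1 = l * C' 0 1 := by
    rcases hne with h | h
    · refine ⟨A' 0 0 / C' 0 0, by field_simp, ?_⟩
      field_simp
      linear_combination -hrel
    · refine ⟨A' 0 1 / C' 0 1, ?_, by field_simp⟩
      field_simp
      linear_combination hrel
  refine ⟨u, ![1 - l, 0, 0], ?_⟩
  change C' = _ * (A' + _ * C')
  clear_value A' C'
  ext i j
  fin_cases i <;> fin_cases j <;>
    simp [symMatrix, Matrix.mul_apply, Fin.sum_univ_two, vecMul, dotProduct, h10, h11, hl0, hl1] <;>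
    ring

/-- Here `A C⁻¹` is symmetric, so `S = 1 - A C⁻¹` is an admissible shear and `A + S C = C`. -/
theorem exists_local_rank_two {A C : Matrix (Fin 2) (Fin 2) F} (hs : Aᵀ * C = Cᵀ * A)
    (hdet : C.det ≠ 0) :
    ∃ (u : SpecialLinearGroup (Fin 2) F) (s : Fin 3 → F), u.1 * C =
      !![1, 0; 0, 1] * (u.1.adjugateᵀ * A + symMatrix s * (u.1 * C)) := by
  have hu : IsUnit C.det := isUnit_iff_ne_zero.2 hdet
  have hsym : (A * C⁻¹)ᵀ = A * C⁻¹ := by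
    rw [transpose_mul]
    have huT : IsUnit Cᵀ.det := by rwa [det_transpose]
    calc C⁻¹ᵀ * Aᵀ = C⁻¹ᵀ * (Aᵀ * C) * C⁻¹ := by
          rw [Matrix.mul_assoc, Matrix.mul_assoc, mul_nonsing_inv _ hu, Matrix.mul_one]
      _ = A * C⁻¹ := by
          rw [hs, transpose_nonsing_inv, ← Matrix.mul_assoc, nonsing_inv_mul _ huT, Matrix.one_mul]
  set S := 1 - A * C⁻¹ with hS
  have hSs : symMatrix ![S 0 0, S 0 1, S 1 1] = S := by
    have h10 : S 1 0 = S 0 1 := by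
      have : Sᵀ = S := by rw [hS, transpose_sub, hsym, transpose_one]
      exact congrFun (congrFun this 0) 1
    ext i j
    fin_cases i <;> fin_cases j <;> simp [symMatrix, h10]
  refine ⟨1, ![S 0 0, S 0 1, S 1 1], ?_⟩
  rw [hSs, ← Matrix.one_fin_two, hS]
  simp [Matrix.sub_mul, Matrix.mul_assoc, nonsing_inv_mul _ hu]

end Local

/-! ### Double cosets as rank conditions. -/

/-- Reduction of an integral matrix modulo `q`. -/
abbrev reduceMat (q : ℕ) : Matrix (Fin 2) (Fin 2) ℤ →+* Matrix (Fin 2) (Fin 2) (ZMod q) :=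
  (Int.castRingHom (ZMod q)).mapMatrix

theorem reduceMat_transpose (q : ℕ) (X : Matrix (Fin 2) (Fin 2) ℤ) :
    reduceMat q Xᵀ = (reduceMat q X)ᵀ := rfl

theorem reduceMat_det (q : ℕ) (X : Matrix (Fin 2) (Fin 2) ℤ) :
    (reduceMat q X).det = (X.det : ZMod q) :=
  ((Int.castRingHom (ZMod q)).map_det X).symm

/-- For primes `q` dividing `N₀`, `N₁`, `N₂` respectively, the block `C` has rank `0`, `1`, `2`
modulo `q`. -/
def HasRanks (N₀ N₁ N₂ : ℕ) (γ : Sp4Z) : Prop :=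
  ∀ q : ℕ, q.Prime → (q ∣ N₀ → reduceMat q (blockC γ) = 0) ∧
    (q ∣ N₁ → reduceMat q (blockC γ) ≠ 0 ∧ (reduceMat q (blockC γ)).det = 0) ∧
    (q ∣ N₂ → (reduceMat q (blockC γ)).det ≠ 0)

namespace CuspMatrix

variable {N₀ N₁ N₂ : ℕ} (M : CuspMatrix N₀ N₁ N₂)

theorem reduceMat_eq_of_dvd {X : Matrix (Fin 2) (Fin 2) ℤ} {n q : ℕ} (h : q ∣ n)
    {Y : Matrix (Fin 2) (Fin 2) (ZMod n)} (hX : X.map (Int.cast : ℤ → ZMod n) = Y) :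
    reduceMat q X = Y.map (ZMod.castHom h (ZMod q)) := by
  rw [← hX]
  ext i j
  simp

theorem reduceMat_of_dvd₀ {q : ℕ} (h : q ∣ N₀) : reduceMat q M.mat = 0 := by
  rw [reduceMat_eq_of_dvd h M.mod₀]
  ext i j
  fin_cases i <;> fin_cases j <;> simp

theorem reduceMat_of_dvd₁ {q : ℕ} (h : q ∣ N₁) : reduceMat q M.mat = !![1, 0; 0, 0] := by
  rw [reduceMat_eq_of_dvd h M.mod₁]
  ext i j
  fin_cases i <;> fin_cases j <;> simp only [Matrix.map_apply, of_apply, cons_val', cons_val_zero, cons_val_one, cons_val_fin_one,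
    Fin.zero_eta, Fin.mk_one, map_zero, map_one]

theorem reduceMat_of_dvd₂ {q : ℕ} (h : q ∣ N₂) : reduceMat q M.mat = !![1, 0; 0, 1] := by
  rw [reduceMat_eq_of_dvd h M.mod₂]
  ext i j
  fin_cases i <;> fin_cases j <;> simp only [Matrix.map_apply, of_apply, cons_val', cons_val_zero, cons_val_one, cons_val_fin_one,
    Fin.zero_eta, Fin.mk_one, map_zero, map_one]

theorem blockC_gamma : blockC M.gamma = M.mat := by
  simp [blockC, gamma]

theorem blockD_gamma : blockD M.gamma = 1 := by
  simp [blockD, gamma]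

theorem blockA_gamma : blockA M.gamma = 1 := by
  simp [blockA, gamma]

end CuspMatrix

theorem blockD_inv (γ : Sp4Z) : blockD γ⁻¹ = (blockA γ)ᵀ := by
  rw [← inv_inv γ, blockA_inv (γ⁻¹), transpose_transpose, inv_inv]

theorem det_reduceMat_blockD_ne_zero {g : Sp4Z} (hg : g ∈ GammaInf) {q : ℕ} (hq : q.Prime) :
    (reduceMat q (blockD g)).det ≠ 0 := by
  have : Fact q.Prime := ⟨hq⟩
  intro h
  rw [reduceMat_det] at h
  have h2 : (((blockD g).det ^ 2 : ℤ) : ZMod q) = 1 := by rw [det_blockD_sq g hg, Int.cast_one]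
  rw [Int.cast_pow, h] at h2
  simp at h2

theorem reduceMat_blockC_of_mem_Gamma0 {N : ℕ} {h : Sp4Z} (hh : h ∈ Gamma0 N) {q : ℕ}
    (hqN : q ∣ N) : reduceMat q (blockC h) = 0 := by
  ext i j
  have h1 : (q : ℤ) ∣ blockC h i j := (Int.natCast_dvd_natCast.2 hqN).trans (hh i j)
  simpa using (ZMod.intCast_zmod_eq_zero_iff_dvd _ _).2 h1

theorem det_reduceMat_blockA_ne_zero {N : ℕ} {h : Sp4Z} (hh : h ∈ Gamma0 N) {q : ℕ}
    (hq : q.Prime) (hqN : q ∣ N) : (reduceMat q (blockA h)).det ≠ 0 := by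
  have : Fact q.Prime := ⟨hq⟩
  have h1 := congrArg (reduceMat q) (block_transpose_relations h).2
  rw [map_sub, map_mul, map_mul, map_one, reduceMat_transpose _ (blockC h),
    reduceMat_blockC_of_mem_Gamma0 hh hqN, transpose_zero, Matrix.mul_zero, sub_zero] at h1
  have h2 := congrArg Matrix.det h1
  rw [det_mul, det_one] at h2
  exact left_ne_zero_of_mul_eq_one h2

/-- Modulo `q ∣ N` the block `C` is `D_g M A_h` with `D_g` and `A_h` invertible, so it has the rank
of `M`. -/
theorem hasRanks_of_mem {N₀ N₁ N₂ : ℕ} (M : CuspMatrix N₀ N₁ N₂) {g h : Sp4Z}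
    (hg : g ∈ GammaInf) (hh : h ∈ Gamma0 (N₀ * N₁ * N₂)) :
    HasRanks N₀ N₁ N₂ (g * M.gamma * h) := by
  intro q hq
  have : Fact q.Prime := ⟨hq⟩
  have hD := det_reduceMat_blockD_ne_zero hg hq
  have hCeq : q ∣ N₀ * N₁ * N₂ → reduceMat q (blockC (g * M.gamma * h)) =
      reduceMat q (blockD g) * (reduceMat q M.mat * reduceMat q (blockA h)) := by
    intro hqN
    have hC : blockC g = 0 := hg
    have : blockC (g * M.gamma * h) = blockD g * (M.mat * blockA h + blockC h) := by
      rw [mul_assoc, blockC_mul, hC, Matrix.zero_mul, zero_add, blockC_mul, M.blockC_gamma,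
        M.blockD_gamma, Matrix.one_mul, ← blockA]
    rw [this, map_mul, map_add, map_mul, reduceMat_blockC_of_mem_Gamma0 hh hqN, add_zero]
  refine ⟨fun hq0 => ?_, fun hq1 => ?_, fun hq2 => ?_⟩
  · rw [hCeq ((hq0.mul_right _).mul_right _), M.reduceMat_of_dvd₀ hq0]
    simp
  · have hqN : q ∣ N₀ * N₁ * N₂ := (hq1.mul_left _).mul_right _
    have hA := det_reduceMat_blockA_ne_zero hh hq hqN
    rw [hCeq hqN, M.reduceMat_of_dvd₁ hq1]
    refine ⟨fun h0 => ?_, ?_⟩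
    · have uD := (isUnit_iff_isUnit_det _).2 (isUnit_iff_ne_zero.2 hD)
      have uA := (isUnit_iff_isUnit_det _).2 (isUnit_iff_ne_zero.2 hA)
      have h1 := uA.mul_left_eq_zero.1 (uD.mul_right_eq_zero.1 h0)
      simpa using congrFun (congrFun h1 0) 0
    · rw [det_mul, det_mul]
      simp [det_fin_two]
  · have hqN : q ∣ N₀ * N₁ * N₂ := hq2.mul_left _
    have hA := det_reduceMat_blockA_ne_zero hh hq hqN
    rw [hCeq hqN, M.reduceMat_of_dvd₂ hq2, ← one_fin_two, Matrix.one_mul, det_mul]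
    exact mul_ne_zero hD hA

/-- The element `(U^{-T}, S U; 0, U)` of `Γ_∞`. -/
def parabolic (U : SpecialLinearGroup (Fin 2) ℤ) (s : Fin 3 → ℤ) : Sp4Z :=
  ⟨fromBlocks U.1.adjugateᵀ (symMatrix s * U.1) 0 U.1, by
    have hs : (symMatrix s)ᵀ = symMatrix s := by
      ext i j
      fin_cases i <;> fin_cases j <;> simp [symMatrix]
    rw [SymplecticGroup.fromBlocks_mem_iff]
    refine ⟨by simp, ?_, ?_⟩
    · rw [transpose_mul, hs, Matrix.mul_assoc]
    · rw [transpose_transpose, adjugate_mul, U.2]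
      simp⟩

theorem parabolic_mem (U : SpecialLinearGroup (Fin 2) ℤ) (s : Fin 3 → ℤ) :
    parabolic U s ∈ GammaInf := by
  change blockC _ = 0
  simp [blockC, parabolic]

theorem blockC_parabolic_mul (U : SpecialLinearGroup (Fin 2) ℤ) (s : Fin 3 → ℤ) (γ : Sp4Z) :
    blockC (parabolic U s * γ) = U.1 * blockC γ := by
  rw [blockC_mul, show blockC (parabolic U s) = 0 from parabolic_mem U s]
  simp [blockD, parabolic]

theorem blockA_parabolic_mul (U : SpecialLinearGroup (Fin 2) ℤ) (s : Fin 3 → ℤ) (γ : Sp4Z) :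
    blockA (parabolic U s * γ) = U.1.adjugateᵀ * blockA γ + symMatrix s * (U.1 * blockC γ) := by
  rw [blockA_mul]
  simp [blockA, blockB, parabolic, Matrix.mul_assoc]

theorem dvd_of_forall_prime_dvd {N : ℕ} (hN : Squarefree N) {x : ℤ}
    (h : ∀ q : ℕ, q.Prime → q ∣ N → (x : ZMod q) = 0) : (N : ℤ) ∣ x := by
  rw [Int.natCast_dvd, ← Nat.prod_primeFactors_of_squarefree hN]
  refine Finset.prod_primes_dvd _ (fun q hq => (Nat.prime_of_mem_primeFactors hq).prime)
    fun q hq => ?_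
  rw [← Int.natCast_dvd]
  exact (ZMod.intCast_zmod_eq_zero_iff_dvd _ _).1
    (h q (Nat.prime_of_mem_primeFactors hq) (Nat.dvd_of_mem_primeFactors hq))

/-- The equation says that the lower-left block of `γ₀⁻¹ g γ` vanishes modulo `q`, where `g` is the
parabolic element built from `u` and `s`. -/
theorem exists_local {N₀ N₁ N₂ : ℕ} (M : CuspMatrix N₀ N₁ N₂) {γ : Sp4Z}
    (hγ : HasRanks N₀ N₁ N₂ γ) {q : ℕ} (hq : q.Prime) (hqN : q ∣ N₀ * N₁ * N₂) :
    ∃ (u : SpecialLinearGroup (Fin 2) (ZMod q)) (s : Fin 3 → ZMod q),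
      u.1 * reduceMat q (blockC γ) = reduceMat q M.mat *
        (u.1.adjugateᵀ * reduceMat q (blockA γ) + symMatrix s * (u.1 * reduceMat q (blockC γ))) := by
  have : Fact q.Prime := ⟨hq⟩
  have hs : (reduceMat q (blockA γ))ᵀ * reduceMat q (blockC γ) =
      (reduceMat q (blockC γ))ᵀ * reduceMat q (blockA γ) := by
    rw [← reduceMat_transpose, ← map_mul, blockA_transpose_mul_blockC, map_mul,
      reduceMat_transpose]
  obtain ⟨h0, h1, h2⟩ := hγ q hq
  rcases hq.dvd_mul.1 hqN with h | h
  · rcases hq.dvd_mul.1 h with h | h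
    · refine ⟨1, 0, ?_⟩
      rw [h0 h, M.reduceMat_of_dvd₀ h]
      simp
    · rw [M.reduceMat_of_dvd₁ h]
      exact exists_local_rank_one hs (h1 h).1 (h1 h).2
  · rw [M.reduceMat_of_dvd₂ h]
    exact exists_local_rank_two hs (h2 h)

theorem exists_parabolic_mul_mem {N₀ N₁ N₂ : ℕ} (hN : Squarefree (N₀ * N₁ * N₂))
    (M : CuspMatrix N₀ N₁ N₂) {γ : Sp4Z} (hγ : HasRanks N₀ N₁ N₂ γ) :
    ∃ g ∈ GammaInf, M.gamma⁻¹ * (g * γ) ∈ Gamma0 (N₀ * N₁ * N₂) := by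
  have hloc : ∀ q : ℕ, ∃ (u : SpecialLinearGroup (Fin 2) (ZMod q)) (s : Fin 3 → ZMod q),
      q ∈ (N₀ * N₁ * N₂).primeFactors → u.1 * reduceMat q (blockC γ) = reduceMat q M.mat *
        (u.1.adjugateᵀ * reduceMat q (blockA γ) +
          symMatrix s * (u.1 * reduceMat q (blockC γ))) := by
    intro q
    by_cases hq : q ∈ (N₀ * N₁ * N₂).primeFactors
    · obtain ⟨u, s, h⟩ := exists_local M hγ (Nat.prime_of_mem_primeFactors hq)
        (Nat.dvd_of_mem_primeFactors hq)
      exact ⟨u, s, fun _ => h⟩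
    · exact ⟨1, 0, fun h => absurd h hq⟩
  choose u s hus using hloc
  have hP : ∀ q ∈ (N₀ * N₁ * N₂).primeFactors, q.Prime := fun q hq =>
    Nat.prime_of_mem_primeFactors hq
  obtain ⟨U, hU⟩ := exists_reduceSL_eq hP u
  have hS : ∀ i : Fin 3, ∃ x : ℤ, ∀ q ∈ (N₀ * N₁ * N₂).primeFactors, (x : ZMod q) = s q i :=
    fun i => exists_intCast_eq hP fun q => s q i
  choose S hS using hS
  refine ⟨parabolic U S, parabolic_mem U S, fun i j => ?_⟩
  refine dvd_of_forall_prime_dvd hN fun q hq hqN => ?_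
  have hqP : q ∈ (N₀ * N₁ * N₂).primeFactors := Nat.mem_primeFactors.2 ⟨hq, hqN, hN.ne_zero⟩
  have hUq : reduceMat q U.1 = (u q).1 := congrArg Subtype.val (hU q hqP)
  have hSq : reduceMat q (symMatrix S) = symMatrix (s q) := by
    ext i j
    fin_cases i <;> fin_cases j <;> simp [symMatrix, hS _ q hqP]
  have hadj : reduceMat q U.1.adjugate = (u q).1.adjugate := by
    rw [← hUq]
    exact RingHom.map_adjugate _ _
  have hmat : blockC (M.gamma⁻¹ * (parabolic U S * γ)) = U.1 * blockC γ -
      M.mat * (U.1.adjugateᵀ * blockA γ + symMatrix S * (U.1 * blockC γ)) := by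
    rw [blockC_mul, ← blockA, blockA_parabolic_mul, blockC_parabolic_mul, blockD_inv, blockC_inv,
      M.blockC_gamma, M.blockA_gamma, M.symm.eq, transpose_one, Matrix.one_mul, Matrix.neg_mul,
      neg_add_eq_sub]
  have hzero : reduceMat q (blockC (M.gamma⁻¹ * (parabolic U S * γ))) = 0 := by
    rw [hmat, map_sub, sub_eq_zero, map_mul, map_mul, map_add, map_mul, map_mul, map_mul,
      reduceMat_transpose, hadj, hUq, hSq]
    exact hus q hqP
  exact congrFun (congrFun hzero i) j

/-- The cosets in `Γ_∞ γ₀ Γ₀(N)` are those for which `C` has the prescribed ranks modulo the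
primes dividing `N`. -/
theorem mk_mem_cuspCosets_iff {N₀ N₁ N₂ : ℕ} (hN : Squarefree (N₀ * N₁ * N₂))
    (M : CuspMatrix N₀ N₁ N₂) (γ : Sp4Z) :
    (Quotient.mk _ γ : Cosets) ∈ cuspCosets M ↔ HasRanks N₀ N₁ N₂ γ := by
  constructor
  · rintro ⟨δ, hδ, hδγ⟩
    rw [DoubleCoset.mem_doubleCoset] at hδ
    obtain ⟨g, hg, h, hh, rfl⟩ := hδ
    have hrel : QuotientGroup.rightRel GammaInf (g * M.gamma * h) γ := Quotient.exact hδγ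
    rw [QuotientGroup.rightRel_apply] at hrel
    have : γ = (γ * (g * M.gamma * h)⁻¹ * g) * M.gamma * h := by group
    rw [this]
    exact hasRanks_of_mem M (GammaInf.mul_mem hrel hg) hh
  · intro hγ
    obtain ⟨g, hg, hmem⟩ := exists_parabolic_mul_mem hN M hγ
    refine ⟨g * γ, ?_, ?_⟩
    · rw [DoubleCoset.mem_doubleCoset]
      exact ⟨1, GammaInf.one_mem, _, hmem, by group⟩
    · refine Quotient.sound ?_
      change QuotientGroup.rightRel GammaInf _ _
      rw [QuotientGroup.rightRel_apply, _root_.mul_inv_rev, mul_inv_cancel_left]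
      exact GammaInf.inv_mem hg

end SiegelEis

/-! ### Splitting by the rank modulo `p`. -/

namespace SiegelEis

theorem hasRanks_mul₀ {N₀ N₁ N₂ p : ℕ} (hp : p.Prime) (γ : Sp4Z) :
    HasRanks (p * N₀) N₁ N₂ γ ↔ HasRanks N₀ N₁ N₂ γ ∧ reduceMat p (blockC γ) = 0 := by
  refine ⟨fun h => ⟨fun q hq => ?_, (h p hp).1 (dvd_mul_right _ _)⟩, fun h q hq => ?_⟩
  · exact ⟨fun hd => (h q hq).1 (hd.mul_left _), (h q hq).2⟩
  · refine ⟨fun hd => ?_, (h.1 q hq).2⟩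
    rcases hq.dvd_mul.1 hd with h1 | h1
    · rw [(Nat.prime_dvd_prime_iff_eq hq hp).1 h1]
      exact h.2
    · exact (h.1 q hq).1 h1

theorem hasRanks_mul₁ {N₀ N₁ N₂ p : ℕ} (hp : p.Prime) (γ : Sp4Z) :
    HasRanks N₀ (p * N₁) N₂ γ ↔ HasRanks N₀ N₁ N₂ γ ∧
      (reduceMat p (blockC γ) ≠ 0 ∧ (reduceMat p (blockC γ)).det = 0) := by
  refine ⟨fun h => ⟨fun q hq => ?_, (h p hp).2.1 (dvd_mul_right _ _)⟩, fun h q hq => ?_⟩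
  · exact ⟨(h q hq).1, fun hd => (h q hq).2.1 (hd.mul_left _), (h q hq).2.2⟩
  · refine ⟨(h.1 q hq).1, fun hd => ?_, (h.1 q hq).2.2⟩
    rcases hq.dvd_mul.1 hd with h1 | h1
    · rw [(Nat.prime_dvd_prime_iff_eq hq hp).1 h1]
      exact h.2
    · exact (h.1 q hq).2.1 h1

theorem hasRanks_mul₂ {N₀ N₁ N₂ p : ℕ} (hp : p.Prime) (γ : Sp4Z) :
    HasRanks N₀ N₁ (p * N₂) γ ↔ HasRanks N₀ N₁ N₂ γ ∧ (reduceMat p (blockC γ)).det ≠ 0 := by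
  refine ⟨fun h => ⟨fun q hq => ?_, (h p hp).2.2 (dvd_mul_right _ _)⟩, fun h q hq => ?_⟩
  · exact ⟨(h q hq).1, (h q hq).2.1, fun hd => (h q hq).2.2 (hd.mul_left _)⟩
  · refine ⟨(h.1 q hq).1, (h.1 q hq).2.1, fun hd => ?_⟩
    rcases hq.dvd_mul.1 hd with h1 | h1
    · rw [(Nat.prime_dvd_prime_iff_eq hq hp).1 h1]
      exact h.2
    · exact (h.1 q hq).2.2 h1

theorem eisConverges {k : ℕ} (hk : 4 ≤ k) {N₀ N₁ N₂ : ℕ} (M : CuspMatrix N₀ N₁ N₂) :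
    EisConverges k M := fun Z => (summable_eisTerm hk Z).subtype (cuspCosets M)

/-- A 2 × 2 matrix over the field with `p` elements is exactly one of zero, nonzero singular, or
invertible. As `p ∤ N`, the new levels are still squarefree, so the rank criterion applies to all
four sets. -/
theorem cuspCosets_decomposition {N₀ N₁ N₂ p : ℕ} (hN : Squarefree (N₀ * N₁ * N₂))
    (hp : p.Prime) (hpN : ¬ p ∣ N₀ * N₁ * N₂) (M : CuspMatrix N₀ N₁ N₂)
    (M₀ : CuspMatrix (p * N₀) N₁ N₂) (M₁ : CuspMatrix N₀ (p * N₁) N₂)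
    (M₂ : CuspMatrix N₀ N₁ (p * N₂)) :
    cuspCosets M = cuspCosets M₀ ∪ cuspCosets M₁ ∪ cuspCosets M₂ ∧
      Disjoint (cuspCosets M₀) (cuspCosets M₁) ∧
      Disjoint (cuspCosets M₀ ∪ cuspCosets M₁) (cuspCosets M₂) := by
  have hpsq : Squarefree (p * (N₀ * N₁ * N₂)) :=
    (Nat.squarefree_mul ((Nat.Prime.coprime_iff_not_dvd hp).2 hpN)).2 ⟨hp.squarefree, hN⟩
  have h₀ : Squarefree (p * N₀ * N₁ * N₂) := by convert hpsq using 1; ring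
  have h₁ : Squarefree (N₀ * (p * N₁) * N₂) := by convert hpsq using 1; ring
  have h₂ : Squarefree (N₀ * N₁ * (p * N₂)) := by convert hpsq using 1; ring
  have hdet : ∀ γ : Sp4Z, reduceMat p (blockC γ) = 0 → (reduceMat p (blockC γ)).det = 0 := by
    intro γ h
    rw [h]
    exact Matrix.det_zero
  refine ⟨?_, ?_, ?_⟩
  · ext c
    induction c using Quotient.inductionOn with
    | h γ =>
      rw [Set.mem_union, Set.mem_union, mk_mem_cuspCosets_iff hN, mk_mem_cuspCosets_iff h₀,
        mk_mem_cuspCosets_iff h₁, mk_mem_cuspCosets_iff h₂, hasRanks_mul₀ hp, hasRanks_mul₁ hp,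
        hasRanks_mul₂ hp]
      generalize reduceMat p (blockC γ) = X
      by_cases h1 : X = 0 <;> by_cases h2 : X.det = 0 <;> simp [h1, h2]
  · rw [Set.disjoint_left]
    intro c
    induction c using Quotient.inductionOn with
    | h γ =>
      rw [mk_mem_cuspCosets_iff h₀, mk_mem_cuspCosets_iff h₁, hasRanks_mul₀ hp, hasRanks_mul₁ hp]
      tauto
  · rw [Set.disjoint_left]
    intro c
    induction c using Quotient.inductionOn with
    | h γ =>
      have := hdet γ
      rw [Set.mem_union, mk_mem_cuspCosets_iff h₀, mk_mem_cuspCosets_iff h₁,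
        mk_mem_cuspCosets_iff h₂, hasRanks_mul₀ hp, hasRanks_mul₁ hp, hasRanks_mul₂ hp]
      tauto

end SiegelEis

theorem corollary2p4 (k : ℕ) (hk4 : 4 ≤ k) (hk : Even k)
    (N N₀ N₁ N₂ p : ℕ) (hN : Squarefree N) (hprod : N₀ * N₁ * N₂ = N)
    (hp : p.Prime) (hpN : ¬ p ∣ N)
    (M : SiegelEis.CuspMatrix N₀ N₁ N₂)
    (M₀ : SiegelEis.CuspMatrix (p * N₀) N₁ N₂)
    (M₁ : SiegelEis.CuspMatrix N₀ (p * N₁) N₂)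
    (M₂ : SiegelEis.CuspMatrix N₀ N₁ (p * N₂)) :
    (SiegelEis.EisConverges k M ∧ SiegelEis.EisConverges k M₀ ∧
      SiegelEis.EisConverges k M₁ ∧ SiegelEis.EisConverges k M₂) ∧
    SiegelEis.eisenstein k M =
      SiegelEis.eisenstein k M₀ + SiegelEis.eisenstein k M₁ + SiegelEis.eisenstein k M₂ := by
  subst hprod
  refine ⟨⟨SiegelEis.eisConverges hk4 M, SiegelEis.eisConverges hk4 M₀,
    SiegelEis.eisConverges hk4 M₁, SiegelEis.eisConverges hk4 M₂⟩, ?_⟩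
  obtain ⟨hunion, hd₁, hd₂⟩ := SiegelEis.cuspCosets_decomposition hN hp hpN M M₀ M₁ M₂
  funext Z
  have hs := SiegelEis.summable_eisTerm hk4 Z
  simp only [SiegelEis.eisenstein, Pi.add_apply]
  rw [hunion, Summable.tsum_union_disjoint hd₂ (hs.subtype _) (hs.subtype _),
    Summable.tsum_union_disjoint hd₁ (hs.subtype _) (hs.subtype _)]
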